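/- Let $(b_j)_{j\ge 0}$ be real numbers with $b_j\ge 0$ for $j\ne 1$ and $0<-b_1=\sum_{j\neq 1}b_j<\infty$, and put $B(u)=\sum_{j\ge 0}b_ju^j$ for $u\in[0,1]$. Let $Q=(q_{ij})_{i,j\ge 0}$ be given by $q_{ij}=i\,b_{j-i+1}$ if $i\ge 1$ and $j\ge i-1$, and $q_{ij}=0$ otherwise. Let $(X(t))_{t\ge 0}$ be a regular Markov branching process with these rates, that is, a continuous-time Markov chain on $\{0,1,2,\dots\}$ whose transition function $P(t)=(p_{ij}(t))$ is honest ($\sum_j p_{ij}(t)=1$ for all $i$ and all $t\ge0$) and satisfies the forward equation $p_{ij}'(t)=\sum_k p_{ik}(t)q_{kj}$ for all $i,j\ge0$ and $t\ge 0$, and whose paths are almost surely right-continuous step functions with finitely many jumps in every bounded time interval. Suppose that $X(0)=1$ almost surely. Let $Y_0(t)$ be the death number (down-crossing number) until time $t$, i.e. the number of $s\in(0,t]$ with $X(s)=X(s-)-1$. Then for all $u,v\in[0,1]$ the initial value problem $$\frac{\partial y}{\partial t}=B(y)-b_0(1-v)\quad(t\ge 0),\qquad y|_{t=0}=u,$$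 has exactly one solution $y=G(t,u,v)$, $t\ge 0$, with values in $[0,1]$, and the probability generating function of $Y_0(t)$ is given by $$E\bigl[v^{Y_0(t)}\bigr]=G(t,1,v),\qquad t\ge 0,\ v\in[0,1].$$ -/

import Mathlib

open MeasureTheory Filter Topology Set
open scoped NNReal

namespace MBP

/-- Branching rates: `b j ≥ 0` for `j ≠ 1` and `0 < -b 1 = ∑_{j ≠ 1} b j < ∞`. -/
structure IsBranchingRate (b : ℕ → ℝ) : Prop where
  nonneg : ∀ j, j ≠ 1 → 0 ≤ b j
  pos : 0 < -b 1
  hasSum : HasSum (fun j => if j = 1 then 0 else b j) (-b 1)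

/-- The branching `Q`-matrix: `q i j = i * b_{j-i+1}` if `i ≥ 1` and `j ≥ i - 1`, and `0` otherwise.
(The natural number `j + 1 - i` is not truncated in the first case.) -/
def qMatrix (b : ℕ → ℝ) (i j : ℕ) : ℝ :=
  if 1 ≤ i ∧ i ≤ j + 1 then (i : ℝ) * b (j + 1 - i) else 0

/-- The function `B(u) = ∑_j b_j u^j` (the series converges absolutely for `u ∈ [0,1]`, and it is
only used there). -/
noncomputable def B (b : ℕ → ℝ) (u : ℝ) : ℝ := ∑' j, b j * u ^ j

/-- `p t i j`, `t ≥ 0`, is an honest transition function on `ℕ`. Honesty (every row sums to `1`)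
expresses that the process is regular, i.e. does not explode. Continuity at `0` is not listed
because it follows from the differential equation in `IsBranchingTransition`. -/
structure IsTransitionFunction (p : ℝ → ℕ → ℕ → ℝ) : Prop where
  nonneg : ∀ t, 0 ≤ t → ∀ i j, 0 ≤ p t i j
  honest : ∀ t, 0 ≤ t → ∀ i, HasSum (fun j => p t i j) 1
  zero : ∀ i j, p 0 i j = if i = j then 1 else 0
  chapman_kolmogorov : ∀ s t, 0 ≤ s → 0 ≤ t → ∀ i j,
    HasSum (fun k => p s i k * p t k j) (p (s + t) i j)

/-- Honest transition functions satisfying the Kolmogorov forward equation `P' = P Q` for the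
branching `Q`-matrix, on `[0, ∞)` (one-sided derivative at `0`). In the sum only the terms with
`k ≤ j + 1` can be nonzero. -/
structure IsBranchingTransition (b : ℕ → ℝ) (p : ℝ → ℕ → ℕ → ℝ) : Prop
    extends IsTransitionFunction p where
  forward : ∀ t, 0 ≤ t → ∀ i j,
    HasDerivWithinAt (fun s => p s i j) (∑' k, p t i k * qMatrix b k j) (Ici 0) t

/-- `X` is a continuous-time Markov chain on `ℕ` with transition function `p`: for all times
`t₀ ≤ … ≤ t_{n+1}` and states `i₀, …, i_{n+1}`,
`P(X_{t₀} = i₀, …, X_{t_{n+1}} = i_{n+1})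
  = P(X_{t₀} = i₀, …, X_{t_n} = i_n) * p_{i_n, i_{n+1}}(t_{n+1} - t_n)`. -/
structure IsMarkovChain {Ω : Type*} [MeasurableSpace Ω] (p : ℝ → ℕ → ℕ → ℝ)
    (X : ℝ≥0 → Ω → ℕ) (μ : Measure Ω) : Prop where
  measurable : ∀ t, Measurable (X t)
  markov : ∀ (n : ℕ) (t : ℕ → ℝ≥0) (i : ℕ → ℕ), Monotone t →
    μ.real {ω | ∀ k ≤ n + 1, X (t k) ω = i k} =
      μ.real {ω | ∀ k ≤ n, X (t k) ω = i k} * p ((t (n + 1) : ℝ) - t n) (i n) (i (n + 1))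

/-- A path in the discrete space `ℕ` that is right-continuous with left limits, i.e. a step
function with finitely many jumps in every bounded time interval. -/
def IsStepPath (x : ℝ≥0 → ℕ) : Prop :=
  ∀ t, (∀ᶠ r in 𝓝[>] t, x r = x t) ∧ ∃ k, ∀ᶠ r in 𝓝[<] t, x r = k

/-- `X` is a (regular) Markov branching process with rates `b`. -/
structure IsMarkovBranchingProcess {Ω : Type*} [MeasurableSpace Ω] (b : ℕ → ℝ)
    (X : ℝ≥0 → Ω → ℕ) (μ : Measure Ω) : Prop where
  rate : IsBranchingRate b
  chain : ∃ p, IsBranchingTransition b p ∧ IsMarkovChain p X μ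
  path : ∀ᵐ ω ∂μ, IsStepPath fun t => X t ω

/-- The death (down-crossing) number `Y₀(t)`: the number of times `s ∈ (0, t]` at which the path
jumps down by one, `X_s = X_{s-} - 1`. This set is finite when the path is a step path. -/
noncomputable def deathNumber {Ω : Type*} (X : ℝ≥0 → Ω → ℕ) (t : ℝ≥0) (ω : Ω) : ℕ :=
  {s : ℝ≥0 | 0 < s ∧ s ≤ t ∧ ∀ᶠ r in 𝓝[<] s, X r ω = X s ω + 1}.ncard

/-- `y : [0, ∞) → [0, 1]` solves `y' = B(y) - b₀ (1 - v)`, `y(0) = u`. -/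
structure IsSolution (b : ℕ → ℝ) (u v : ℝ) (y : ℝ → ℝ) : Prop where
  mem : ∀ t, 0 ≤ t → y t ∈ Icc (0 : ℝ) 1
  init : y 0 = u
  deriv : ∀ t, 0 ≤ t → HasDerivWithinAt y (B b (y t) - b 0 * (1 - v)) (Ici 0) t

end MBP

/-! For `u < 1` the joint generating function `E[v^{Y₀(t)} u^{X(t)}]` is the solution started at
`u`; the theorem is the limit `u → 1`.

Below `1` the function `B` is Lipschitz, and `B(x) ≤ b₀(1 - x)` gives a barrier keeping solutions
away from `1`, so the problem is globally well posed for `u < 1`. The forward equation gives the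
branching property: with `i` ancestors, `E[u^{X(t)}] = y(t)^i`, where `y` is the solution for `v =
1` (`IsBranchingTransition.hasSum_mul_pow`). Weighting a step `i → i - 1` by `v` then reproduces
`z(h)^i`, with `z` the solution for `v`, up to an error `O(h²)` uniform in `i`
(`IsBranchingTransition.exists_step_bound`). Telescoping this over a grid with the Markov property,
and observing that on a fine grid the decrements of a step path count its down-crossings, gives the
joint formula (`IsMarkovBranchingProcess.integral_pow_mul_pow`).

As `u → 1` the integral equation survives, so the generating function of `Y₀` solves the problem
with initial value `1`. There `B` may have infinite slope, and uniqueness is obtained from the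
process: once a solution drops below `1`, restarting it just after the drop identifies it with the
generating function (`IsMarkovBranchingProcess.eq_deathPGF_of_lt_one`). If `b₀(1 - v) ≠ 0` it drops
at once; otherwise the generating function is constantly `1`, so it never drops. -/

namespace MBP

/-! ### Branching rates, the function `B` and the rows of the `Q`-matrix. -/

section Rates

variable {b : ℕ → ℝ}

theorem IsBranchingRate.abs_eq (hb : IsBranchingRate b) (j : ℕ) :
    |b j| = (if j = 1 then 0 else b j) + if j = 1 then -b 1 else 0 := by
  have := hb.pos
  split_ifs with h
  · subst h; rw [abs_of_neg (by linarith)]; ring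
  · rw [abs_of_nonneg (hb.nonneg j h)]; ring

theorem IsBranchingRate.hasSum_abs (hb : IsBranchingRate b) :
    HasSum (fun j => |b j|) (2 * -b 1) := by
  have h := hb.hasSum.add (hasSum_ite_eq 1 (-b 1))
  rw [two_mul]
  exact h.congr_fun fun j => hb.abs_eq j

theorem IsBranchingRate.hasSum_zero (hb : IsBranchingRate b) : HasSum b 0 := by
  have h := hb.hasSum.add (hasSum_ite_eq 1 (b 1))
  rw [neg_add_cancel] at h
  refine h.congr_fun fun j => ?_
  split_ifs with h
  · subst h; simp
  · simp

theorem IsBranchingRate.abs_le (hb : IsBranchingRate b) (j : ℕ) : |b j| ≤ -b 1 := by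
  have hpos := hb.pos
  rcases eq_or_ne j 1 with rfl | h
  · rw [abs_of_neg (by linarith)]
  · have := le_hasSum hb.hasSum j fun i _ => by
      split_ifs with hi
      · exact le_rfl
      · exact hb.nonneg i hi
    rwa [if_neg h, ← abs_of_nonneg (hb.nonneg j h)] at this

theorem abs_mul_pow_le {b : ℕ → ℝ} {x : ℝ} (hx : x ∈ Icc (0 : ℝ) 1) (j : ℕ) :
    |b j * x ^ j| ≤ |b j| := by
  rw [abs_mul, abs_of_nonneg (pow_nonneg hx.1 j)]
  exact mul_le_of_le_one_right (abs_nonneg _) (pow_le_one₀ hx.1 hx.2)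

theorem IsBranchingRate.hasSum_B (hb : IsBranchingRate b) {x : ℝ} (hx : x ∈ Icc (0 : ℝ) 1) :
    HasSum (fun j => b j * x ^ j) (B b x) :=
  (Summable.of_norm_bounded hb.hasSum_abs.summable fun j => abs_mul_pow_le hx j).hasSum

theorem IsBranchingRate.abs_B_le (hb : IsBranchingRate b) {x : ℝ} (hx : x ∈ Icc (0 : ℝ) 1) :
    |B b x| ≤ 2 * -b 1 :=
  tsum_of_norm_bounded (f := fun j => b j * x ^ j) hb.hasSum_abs fun j => abs_mul_pow_le hx j

theorem B_at_zero (b : ℕ → ℝ) : B b 0 = b 0 := by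
  rw [B, tsum_eq_single 0 (fun j hj => by simp [hj])]
  simp

theorem IsBranchingRate.B_at_one (hb : IsBranchingRate b) : B b 1 = 0 := by
  simpa [B] using hb.hasSum_zero.tsum_eq

/-- For `j ≥ 2` replace `x ^ j` by the larger `x`; since the `b j` sum to zero, only the correction
at `j = 0` remains. This linear bound at `1` holds even when `B` has infinite slope there. -/
theorem IsBranchingRate.B_le (hb : IsBranchingRate b) {x : ℝ} (hx : x ∈ Icc (0 : ℝ) 1) :
    B b x ≤ b 0 * (1 - x) := by
  have h₁ : HasSum (fun j => b j * x + if j = 0 then b 0 * (1 - x) else 0)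
      (0 * x + b 0 * (1 - x)) :=
    (hb.hasSum_zero.mul_right x).add (hasSum_ite_eq 0 _)
  rw [zero_mul, zero_add] at h₁
  refine hasSum_le (fun j => ?_) (hb.hasSum_B hx) h₁
  rcases j with _ | _ | j
  · simp; linarith
  · simp
  · have : x ^ (j + 1 + 1) ≤ x := pow_le_of_le_one hx.1 hx.2 (by omega)
    simpa using mul_le_mul_of_nonneg_left this (hb.nonneg (j + 1 + 1) (by omega))

theorem IsBranchingRate.continuousOn_B (hb : IsBranchingRate b) :
    ContinuousOn (B b) (Icc 0 1) :=
  continuousOn_tsum (fun j => by fun_prop) hb.hasSum_abs.summable fun j _ hx => abs_mul_pow_le hx j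

theorem abs_pow_sub_pow_le_of_mem_Icc {r x y : ℝ} (hx : x ∈ Icc 0 r) (hy : y ∈ Icc 0 r) (j : ℕ) :
    |x ^ j - y ^ j| ≤ j * r ^ (j - 1) * |x - y| := by
  refine (abs_pow_sub_pow_le x y j).trans ?_
  rw [mul_assoc, mul_comm]
  gcongr
  rw [abs_of_nonneg hx.1, abs_of_nonneg hy.1]
  exact max_le hx.2 hy.2

theorem summable_natCast_mul_pow_pred {r : ℝ} (h0 : 0 ≤ r) (h1 : r < 1) :
    Summable fun j : ℕ => (j : ℝ) * r ^ (j - 1) := by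
  rw [← summable_nat_add_iff 1]
  have h := (summable_pow_mul_geometric_of_norm_lt_one 1
    (by rwa [Real.norm_of_nonneg h0] : ‖r‖ < 1)).add (summable_geometric_of_lt_one h0 h1)
  refine h.congr fun j => ?_
  simp
  ring

theorem IsBranchingRate.exists_lipschitz_B (hb : IsBranchingRate b) {r : ℝ} (h0 : 0 ≤ r)
    (h1 : r < 1) : ∃ K, 0 ≤ K ∧ ∀ x ∈ Icc 0 r, ∀ y ∈ Icc 0 r, |B b x - B b y| ≤ K * |x - y| := by
  have hs := (summable_natCast_mul_pow_pred h0 h1).mul_left (-b 1)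
  refine ⟨∑' j : ℕ, -b 1 * (j * r ^ (j - 1)), tsum_nonneg fun j => ?_, fun x hx y hy => ?_⟩
  · have := hb.pos
    positivity
  · rw [← ((hb.hasSum_B ⟨hx.1, hx.2.trans h1.le⟩).sub
      (hb.hasSum_B ⟨hy.1, hy.2.trans h1.le⟩)).tsum_eq]
    refine tsum_of_norm_bounded (f := fun j => b j * x ^ j - b j * y ^ j)
      (hs.hasSum.mul_right _) fun j => ?_
    rw [← mul_sub, Real.norm_eq_abs, abs_mul, mul_assoc]
    exact mul_le_mul (hb.abs_le j) (abs_pow_sub_pow_le_of_mem_Icc hx hy j) (abs_nonneg _) hb.pos.le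

/-- A nonzero entry in column `j` has `k ≤ j + 1`. The bound does not depend on `k`, so columns can
be summed against `p t i` without any moment assumption. -/
theorem IsBranchingRate.abs_qMatrix_le (hb : IsBranchingRate b) (k j : ℕ) :
    |qMatrix b k j| ≤ (j + 1) * -b 1 := by
  have := hb.pos
  unfold qMatrix
  split_ifs with h
  · rw [abs_mul, Nat.abs_cast]
    exact mul_le_mul (by exact_mod_cast h.2) (hb.abs_le _) (abs_nonneg _) (by positivity)
  · rw [abs_zero]; positivity

theorem IsBranchingRate.hasSum_qMatrix_mul_pow (hb : IsBranchingRate b) {x : ℝ}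
    (hx : x ∈ Icc (0 : ℝ) 1) (k : ℕ) :
    HasSum (fun j => qMatrix b k j * x ^ j) (k * x ^ (k - 1) * B b x) := by
  rcases k with _ | m
  · simp [qMatrix]
  · rw [← (add_left_injective m).hasSum_iff]
    · refine ((hb.hasSum_B hx).mul_left _).congr_fun fun j => ?_
      have : j + m + 1 - (m + 1) = j := by omega
      simp only [Function.comp_apply, qMatrix, this, Nat.add_sub_cancel]
      rw [if_pos (by omega), pow_add]
      ring
    · intro j hj
      have : ¬ (m ≤ j) := fun h => hj ⟨j - m, by simp; omega⟩
      rw [qMatrix, if_neg (by omega), zero_mul]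

end Rates

/-! ### Well-posedness of the differential equation for initial values below `1`. -/

section ODE

/-- An upper barrier for solutions starting from `u < 1`; it stays below `1`. -/
noncomputable def barrier (β u t : ℝ) : ℝ := 1 - (1 - u) * Real.exp (-(β + 1) * t)

theorem barrier_at_zero (β u : ℝ) : barrier β u 0 = u := by simp [barrier]

theorem barrier_lt_one {u : ℝ} (hu : u < 1) (β t : ℝ) : barrier β u t < 1 := by
  have := mul_pos (sub_pos.2 hu) (Real.exp_pos (-(β + 1) * t))
  unfold barrier
  linarith

theorem barrier_mono {β u : ℝ} (hβ : 0 ≤ β) (hu : u ≤ 1) : Monotone (barrier β u) := by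
  intro s t hst
  unfold barrier
  have : Real.exp (-(β + 1) * t) ≤ Real.exp (-(β + 1) * s) := Real.exp_le_exp.2 (by nlinarith)
  nlinarith

theorem le_barrier {β u : ℝ} (hβ : 0 ≤ β) (hu : u < 1) (t : ℝ) (ht : 0 ≤ t) :
    u ≤ barrier β u t := by
  simpa [barrier_at_zero] using barrier_mono hβ hu.le ht

theorem hasDerivAt_barrier (β u t : ℝ) :
    HasDerivAt (barrier β u) ((β + 1) * (1 - barrier β u t)) t := by
  have h := ((((hasDerivAt_id t).const_mul (-(β + 1))).exp).const_mul (1 - u)).const_sub 1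
  refine h.congr_deriv ?_
  simp [barrier]
  ring

/-- The rate `β + 1` in `barrier`, instead of `β`, makes the inequality of derivatives strict at a
contact point, as the comparison principle demands. -/
theorem image_le_barrier {y y' : ℝ → ℝ} {β u T : ℝ} (hu : u < 1)
    (hy : ContinuousOn y (Icc 0 T)) (hy' : ∀ t ∈ Ico 0 T, HasDerivWithinAt y (y' t) (Ici t) t)
    (h0 : y 0 ≤ u) (h : ∀ t ∈ Ico 0 T, y t = barrier β u t → y' t ≤ β * (1 - y t)) :
    ∀ t ∈ Icc 0 T, y t ≤ barrier β u t := by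
  refine image_le_of_deriv_right_lt_deriv_boundary hy hy' (by rwa [barrier_at_zero])
    (hasDerivAt_barrier β u) fun t ht heq => ?_
  have h₁ := h t ht heq
  have h₂ := barrier_lt_one hu β t
  rw [heq] at h₁
  linarith

theorem image_nonneg_of_deriv_nonneg {y y' : ℝ → ℝ} {T : ℝ} (hT : 0 ≤ T)
    (hy : ContinuousOn y (Icc 0 T)) (hy' : ∀ t ∈ Ico 0 T, HasDerivWithinAt y (y' t) (Ici t) t)
    (h0 : 0 ≤ y 0) (h : ∀ t ∈ Ico 0 T, y t ≤ 0 → 0 ≤ y' t) :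
    ∀ t ∈ Icc 0 T, 0 ≤ y t := by
  intro t ht
  refine le_of_forall_pos_le_add fun ε hε => ?_
  -- A strictly increasing barrier for `-y`, at most `ε` on `[0, T]`: at a contact point `y < 0`,
  -- where `y' ≥ 0` by assumption.
  have key := image_le_of_deriv_right_lt_deriv_boundary (f := fun s => -y s)
    (f' := fun s => -y' s) (B := fun s => ε / (1 + T) * (1 + s)) (B' := fun _ => ε / (1 + T) * 1)
    hy.neg (fun s hs => (hy' s hs).neg)
    (by have : 0 ≤ ε / (1 + T) * (1 + 0) := by positivity
        linarith)
    (fun s => ((hasDerivAt_id s).const_add 1).const_mul _)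
    (fun s hs heq => by
      have hε' : 0 < ε / (1 + T) := by positivity
      have hpos : 0 < ε / (1 + T) * (1 + s) := mul_pos hε' (by linarith [hs.1])
      have := h s hs (by linarith)
      linarith) ht
  have h₁ : ε / (1 + T) * (1 + t) ≤ ε / (1 + T) * (1 + T) := by
    gcongr
    exact ht.2
  rw [div_mul_cancel₀ _ (by positivity)] at h₁
  linarith

variable {b : ℕ → ℝ} {u v : ℝ} {y z : ℝ → ℝ}

theorem IsSolution.continuousOn (hy : IsSolution b u v y) : ContinuousOn y (Ici 0) :=
  fun t ht => (hy.deriv t ht).continuousWithinAt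

theorem abs_B_sub_le (hb : IsBranchingRate b) (hv : v ∈ Icc (0 : ℝ) 1) {x : ℝ}
    (hx : x ∈ Icc (0 : ℝ) 1) : |B b x - b 0 * (1 - v)| ≤ 3 * -b 1 := by
  have h₁ : |b 0 * (1 - v)| ≤ -b 1 * 1 := by
    rw [abs_mul]
    exact mul_le_mul (hb.abs_le 0) (by rw [abs_le]; constructor <;> linarith [hv.1, hv.2])
      (abs_nonneg _) hb.pos.le
  have h₂ := abs_sub (B b x) (b 0 * (1 - v))
  have h₃ := hb.abs_B_le hx
  linarith

theorem IsSolution.abs_sub_le (hb : IsBranchingRate b) (hv : v ∈ Icc (0 : ℝ) 1)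
    (hy : IsSolution b u v y) {s t : ℝ} (hs : 0 ≤ s) (ht : 0 ≤ t) :
    |y t - y s| ≤ 3 * -b 1 * |t - s| :=
  (convex_Ici (0 : ℝ)).norm_image_sub_le_of_norm_hasDerivWithin_le
    (fun x hx => hy.deriv x hx) (fun x hx => abs_B_sub_le hb hv (hy.mem x hx)) hs ht

theorem IsSolution.shift (hy : IsSolution b u v y) {s : ℝ} (hs : 0 ≤ s) :
    IsSolution b (y s) v fun t => y (s + t) where
  mem t ht := hy.mem _ (add_nonneg hs ht)
  init := by simp
  deriv t ht := by
    have h := (hy.deriv (s + t) (add_nonneg hs ht)).scomp t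
      (((hasDerivAt_id t).const_add s).hasDerivWithinAt (s := Ici 0))
      (fun x hx => add_nonneg hs hx)
    simpa [Function.comp_def] using h

theorem IsSolution.le_barrier (hb : IsBranchingRate b) (hv : v ∈ Icc (0 : ℝ) 1) {r : ℝ}
    (hr : r < 1) (hur : u ≤ r) (hy : IsSolution b u v y) {t : ℝ} (ht : 0 ≤ t) :
    y t ≤ barrier (b 0) r t := by
  refine image_le_barrier hr (hy.continuousOn.mono Icc_subset_Ici_self)
    (fun s hs => (hy.deriv s hs.1).mono (Ici_subset_Ici.2 hs.1)) (by rwa [hy.init])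
    (fun s hs _ => ?_) t ⟨ht, le_rfl⟩
  have h₁ := hb.B_le (hy.mem s hs.1)
  have h₂ := mul_nonneg (hb.nonneg 0 (by norm_num)) (sub_nonneg.2 hv.2)
  linarith

theorem IsSolution.lt_one (hb : IsBranchingRate b) (hv : v ∈ Icc (0 : ℝ) 1)
    (hu : u < 1) (hy : IsSolution b u v y) {t : ℝ} (ht : 0 ≤ t) : y t < 1 :=
  (hy.le_barrier hb hv hu le_rfl ht).trans_lt (barrier_lt_one hu _ _)

theorem IsSolution.unique (hb : IsBranchingRate b) (hv : v ∈ Icc (0 : ℝ) 1) (hu : u ∈ Ico (0 : ℝ) 1)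
    (hy : IsSolution b u v y) (hz : IsSolution b u v z) {t : ℝ} (ht : 0 ≤ t) : y t = z t := by
  have hb0 := hb.nonneg 0 (by norm_num)
  set r := barrier (b 0) u t with hr
  have hr0 : 0 ≤ r := hu.1.trans (MBP.le_barrier hb0 hu.2 t ht)
  obtain ⟨K, hK, hL⟩ := hb.exists_lipschitz_B hr0 (barrier_lt_one hu.2 _ _)
  have hmem : ∀ {w : ℝ → ℝ}, IsSolution b u v w → ∀ s ∈ Ico 0 t, w s ∈ Icc 0 r := fun hw s hs =>
    ⟨(hw.mem s hs.1).1, (hw.le_barrier hb hv hu.2 le_rfl hs.1).trans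
      (barrier_mono hb0 hu.2.le hs.2.le)⟩
  refine ODE_solution_unique_of_mem_Icc_right (v := fun _ x => B b x - b 0 * (1 - v))
    (s := fun _ => Icc 0 r) (K := ⟨K, hK⟩) (fun s _ => ?_)
    (hy.continuousOn.mono Icc_subset_Ici_self)
    (fun s hs => (hy.deriv s hs.1).mono (Ici_subset_Ici.2 hs.1)) (hmem hy)
    (hz.continuousOn.mono Icc_subset_Ici_self)
    (fun s hs => (hz.deriv s hs.1).mono (Ici_subset_Ici.2 hs.1)) (hmem hz)
    (by rw [hy.init, hz.init]) ⟨ht, le_rfl⟩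
  refine LipschitzOnWith.of_dist_le_mul fun p hp q hq => ?_
  rw [Real.dist_eq, Real.dist_eq, sub_sub_sub_cancel_right]
  exact hL p hp q hq

theorem exists_solution_Icc (hb : IsBranchingRate b) (hv : v ∈ Icc (0 : ℝ) 1)
    (hu : u ∈ Ico (0 : ℝ) 1) {T : ℝ} (hT : 0 ≤ T) :
    ∃ y : ℝ → ℝ, y 0 = u ∧ ∀ t ∈ Icc 0 T, y t ∈ Icc 0 (barrier (b 0) u T) ∧
      HasDerivWithinAt y (B b (y t) - b 0 * (1 - v)) (Icc 0 T) t := by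
  have hb0 := hb.nonneg 0 (by norm_num)
  have hc := hb.pos
  set r := barrier (b 0) u T with hr
  have hr0 : 0 ≤ r := hu.1.trans (MBP.le_barrier hb0 hu.2 T hT)
  have hr1 : r < 1 := barrier_lt_one hu.2 _ _
  obtain ⟨K, hK, hL⟩ := hb.exists_lipschitz_B hr0 hr1
  -- Clamping the argument to `[0, r]` makes the field bounded and Lipschitz on all of `ℝ`, so
  -- Picard–Lindelöf covers `[0, T]` in one go. Afterwards the solution is shown to stay in `[0,
  -- r]`, where the clamp does nothing.
  set g : ℝ → ℝ := fun x => B b (projIcc 0 r hr0 x) - b 0 * (1 - v) with hg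
  have hmem : ∀ x, (projIcc 0 r hr0 x : ℝ) ∈ Icc (0 : ℝ) 1 := fun x =>
    ⟨(projIcc 0 r hr0 x).2.1, (projIcc 0 r hr0 x).2.2.trans hr1.le⟩
  have hPL : IsPicardLindelof (fun _ => g) (⟨0, le_rfl, hT⟩ : Icc 0 T) u
      (⟨3 * -b 1 * T, by positivity⟩ : ℝ≥0) 0 ⟨3 * -b 1, by positivity⟩ ⟨K, hK⟩ := by
    refine ⟨fun t _ => ?_, fun x _ => continuousOn_const, fun t _ x _ => ?_, ?_⟩
    · refine LipschitzOnWith.of_dist_le_mul fun p _ q _ => ?_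
      rw [Real.dist_eq, Real.dist_eq, sub_sub_sub_cancel_right]
      refine (hL _ (projIcc 0 r hr0 p).2 _ (projIcc 0 r hr0 q).2).trans ?_
      exact mul_le_mul_of_nonneg_left (abs_projIcc_sub_projIcc hr0) hK
    · exact abs_B_sub_le hb hv (hmem x)
    · change 3 * -b 1 * max (T - 0) (0 - 0) ≤ 3 * -b 1 * T - 0
      simp [hT]
  obtain ⟨y, hy0, hy⟩ := hPL.exists_eq_forall_mem_Icc_hasDerivWithinAt₀
  have hcont : ContinuousOn y (Icc 0 T) := fun t ht => (hy t ht).continuousWithinAt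
  have hy' : ∀ t ∈ Ico 0 T, HasDerivWithinAt y (g (y t)) (Ici t) t := fun t ht =>
    (hy t (Ico_subset_Icc_self ht)).mono_of_mem_nhdsWithin (Icc_mem_nhdsGE_of_mem ht)
  have hnn : ∀ t ∈ Icc 0 T, 0 ≤ y t := by
    refine image_nonneg_of_deriv_nonneg hT hcont hy' (hy0 ▸ hu.1) fun t _ hneg => ?_
    -- Below `0` the clamped field equals `b 0 * v ≥ 0`.
    simp only [hg, projIcc_of_le_left hr0 hneg, B_at_zero]
    nlinarith [hv.1]
  have hle : ∀ t ∈ Icc 0 T, y t ≤ r := by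
    refine fun t ht => (image_le_barrier (β := b 0) hu.2 hcont hy' hy0.le
      (fun s hs heq => ?_) t ht).trans (barrier_mono hb0 hu.2.le ht.2)
    have hs' : y s ∈ Icc 0 r := ⟨hnn s (Ico_subset_Icc_self hs),
      heq.trans_le (barrier_mono hb0 hu.2.le hs.2.le)⟩
    simp only [hg, projIcc_of_mem hr0 hs']
    have h₁ := hb.B_le ⟨hs'.1, hs'.2.trans hr1.le⟩
    have h₂ := mul_nonneg hb0 (sub_nonneg.2 hv.2)
    linarith
  refine ⟨y, hy0, fun t ht => ⟨⟨hnn t ht, hle t ht⟩, ?_⟩⟩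
  have h := hy t ht
  simpa only [hg, projIcc_of_mem hr0 ⟨hnn t ht, hle t ht⟩] using h

theorem exists_solution (hb : IsBranchingRate b) (hv : v ∈ Icc (0 : ℝ) 1)
    (hu : u ∈ Ico (0 : ℝ) 1) : ∃ y, IsSolution b u v y := by
  have hb0 := hb.nonneg 0 (by norm_num)
  choose! Y hY0 hY using fun (T : ℝ) (hT : 0 ≤ T) => exists_solution_Icc hb hv hu hT
  have hIci : ∀ {S T t : ℝ}, 0 ≤ t → t < S → S ≤ T →
      HasDerivWithinAt (Y T) (B b (Y T t) - b 0 * (1 - v)) (Ici t) t := fun h0 hS hST =>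
    ((hY _ (by linarith) _ ⟨h0, by linarith⟩).2).mono_of_mem_nhdsWithin
      (Icc_mem_nhdsGE_of_mem ⟨h0, by linarith⟩)
  have huniq : ∀ {S T t : ℝ}, 0 ≤ t → t ≤ S → S ≤ T → Y S t = Y T t := by
    intro S T t h0 hS hST
    have hS0 : 0 ≤ S := h0.trans hS
    have hr0 : 0 ≤ barrier (b 0) u T := hu.1.trans (MBP.le_barrier hb0 hu.2 T (hS0.trans hST))
    obtain ⟨K, hK, hL⟩ := hb.exists_lipschitz_B hr0 (barrier_lt_one hu.2 _ _)
    refine ODE_solution_unique_of_mem_Icc_right (v := fun _ x => B b x - b 0 * (1 - v))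
      (s := fun _ => Icc 0 (barrier (b 0) u T)) (K := ⟨K, hK⟩) (fun s _ => ?_)
      (fun s hs => (hY S hS0 s hs).2.continuousWithinAt)
      (fun s hs => hIci hs.1 hs.2 le_rfl)
      (fun s hs => Icc_subset_Icc_right (barrier_mono hb0 hu.2.le hST)
        (hY S hS0 s (Ico_subset_Icc_self hs)).1)
      (fun s hs => ((hY T (hS0.trans hST) s ⟨hs.1, hs.2.trans hST⟩).2.continuousWithinAt).mono
        (Icc_subset_Icc_right hST))
      (fun s hs => hIci hs.1 hs.2 hST)
      (fun s hs => (hY T (hS0.trans hST) s ⟨hs.1, hs.2.le.trans hST⟩).1)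
      (by rw [hY0 S hS0, hY0 T (hS0.trans hST)]) ⟨h0, hS⟩
    refine LipschitzOnWith.of_dist_le_mul fun p hp q hq => ?_
    rw [Real.dist_eq, Real.dist_eq, sub_sub_sub_cancel_right]
    exact hL p hp q hq
  -- The horizon `t + 1` leaves room to the right of `t`, so that near `t` the glued function agrees
  -- with the single solution `Y (t + 1)`.
  refine ⟨fun t => Y (t + 1) t, fun t ht => ?_, hY0 _ (by norm_num), fun t ht => ?_⟩
  · have h := (hY (t + 1) (by linarith) t ⟨ht, by linarith⟩).1
    exact ⟨h.1, h.2.trans (barrier_lt_one hu.2 _ _).le⟩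
  · have hmem : Icc 0 (t + 1) ∈ 𝓝[Ici 0] t := by
      rw [← Ici_inter_Iic]
      exact inter_mem self_mem_nhdsWithin
        (mem_nhdsWithin_of_mem_nhds (Iic_mem_nhds (lt_add_one t)))
    have h := (hY (t + 1) (by linarith) t ⟨ht, by linarith⟩).2.mono_of_mem_nhdsWithin hmem
    refine h.congr_of_eventuallyEq ?_ rfl
    filter_upwards [hmem] with s hs
    rcases le_total s t with hst | hst
    · exact huniq hs.1 (by linarith) (by linarith)
    · exact (huniq hs.1 hs.2 (by linarith)).symm

end ODE

/-! ### From the forward equation to the branching property. -/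

section Forward

variable {b : ℕ → ℝ} {p : ℝ → ℕ → ℕ → ℝ}

theorem IsTransitionFunction.le_one (hp : IsTransitionFunction p) {t : ℝ} (ht : 0 ≤ t) (i j : ℕ) :
    p t i j ≤ 1 :=
  le_hasSum (hp.honest t ht i) j fun k _ => hp.nonneg t ht i k

theorem IsTransitionFunction.summable_mul_of_le (hp : IsTransitionFunction p) {t : ℝ} (ht : 0 ≤ t)
    (i : ℕ) {g : ℕ → ℝ} {C : ℝ} (hg : ∀ k, |g k| ≤ C) : Summable fun k => p t i k * g k :=
  Summable.of_norm_bounded ((hp.honest t ht i).summable.mul_right C) fun k => by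
    rw [Real.norm_eq_abs, abs_mul, abs_of_nonneg (hp.nonneg t ht i k)]
    exact mul_le_mul_of_nonneg_left (hg k) (hp.nonneg t ht i k)

theorem IsTransitionFunction.abs_tsum_mul_le (hp : IsTransitionFunction p) {t : ℝ} (ht : 0 ≤ t)
    (i : ℕ) {g : ℕ → ℝ} {C : ℝ} (hg : ∀ k, |g k| ≤ C) : |∑' k, p t i k * g k| ≤ C := by
  refine tsum_of_norm_bounded (f := fun k => p t i k * g k)
    (by simpa using (hp.honest t ht i).mul_right C) fun k => ?_
  rw [Real.norm_eq_abs, abs_mul, abs_of_nonneg (hp.nonneg t ht i k)]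
  exact mul_le_mul_of_nonneg_left (hg k) (hp.nonneg t ht i k)

theorem IsBranchingTransition.abs_deriv_le (hb : IsBranchingRate b) (hp : IsBranchingTransition b p)
    {t : ℝ} (ht : 0 ≤ t) (i j : ℕ) : |∑' k, p t i k * qMatrix b k j| ≤ (j + 1) * -b 1 :=
  hp.abs_tsum_mul_le ht i fun k => hb.abs_qMatrix_le k j

theorem IsBranchingTransition.continuousOn (hp : IsBranchingTransition b p) (i j : ℕ) :
    ContinuousOn (fun t => p t i j) (Ici 0) :=
  fun t ht => (hp.forward t ht i j).continuousWithinAt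

theorem IsBranchingTransition.one_sub_diag_le (hb : IsBranchingRate b)
    (hp : IsBranchingTransition b p) {t : ℝ} (ht : 0 ≤ t) (i : ℕ) :
    1 - p t i i ≤ (i + 1) * -b 1 * t := by
  have h := (convex_Ici (0 : ℝ)).norm_image_sub_le_of_norm_hasDerivWithin_le
    (fun x hx => hp.forward x hx i i) (fun x hx => hp.abs_deriv_le hb hx i i)
    (mem_Ici.2 le_rfl) (mem_Ici.2 ht)
  rw [hp.zero, if_pos rfl, sub_zero, Real.norm_of_nonneg ht, Real.norm_eq_abs, abs_sub_comm] at h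
  exact (le_abs_self _).trans h

/-- The forward equation in terms of generating functions. -/
theorem IsBranchingTransition.hasSum_deriv_mul_pow (hb : IsBranchingRate b)
    (hp : IsBranchingTransition b p) {t : ℝ} (ht : 0 ≤ t) (i : ℕ) {x : ℝ} (hx : x ∈ Ico (0 : ℝ) 1) :
    HasSum (fun j => (∑' k, p t i k * qMatrix b k j) * x ^ j)
      (∑' k, p t i k * (k * x ^ (k - 1) * B b x)) := by
  have hc := hb.pos
  have hgeo : Summable fun j : ℕ => ((j : ℝ) + 1) * -b 1 * x ^ j := by
    have h := ((summable_pow_mul_geometric_of_norm_lt_one 1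
      (by rw [Real.norm_of_nonneg hx.1]; exact hx.2 : ‖x‖ < 1)).add
      (summable_geometric_of_lt_one hx.1 hx.2)).mul_left (-b 1)
    exact h.congr fun j => by ring
  -- Fubini: the column bound gives the product majorant `p t i k * ((j + 1) * -b 1 * x ^ j)`,
  -- summable because `x < 1`.
  have hsum : Summable fun z : ℕ × ℕ => p t i z.1 * qMatrix b z.1 z.2 * x ^ z.2 := by
    refine Summable.of_norm_bounded ((hp.honest t ht i).summable.mul_of_nonneg hgeo
      (fun k => hp.nonneg t ht i k) fun j => mul_nonneg (by positivity) (pow_nonneg hx.1 j))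
      fun z => ?_
    rw [Real.norm_eq_abs, abs_mul, abs_mul, abs_of_nonneg (hp.nonneg t ht i z.1),
      abs_of_nonneg (pow_nonneg hx.1 z.2), mul_assoc]
    exact mul_le_mul_of_nonneg_left (mul_le_mul_of_nonneg_right (hb.abs_qMatrix_le _ _)
      (pow_nonneg hx.1 _)) (hp.nonneg t ht i z.1)
  have hrow : ∀ k, ∑' j, p t i k * qMatrix b k j * x ^ j = p t i k * (k * x ^ (k - 1) * B b x) :=
    fun k => by
      simp only [mul_assoc]
      simpa only [mul_assoc] using
        ((hb.hasSum_qMatrix_mul_pow ⟨hx.1, hx.2.le⟩ k).mul_left (p t i k)).tsum_eq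
  have hcol : ∀ j, ∑' k, p t i k * qMatrix b k j * x ^ j
      = (∑' k, p t i k * qMatrix b k j) * x ^ j := fun j => tsum_mul_right
  have h := hsum.prod_symm.prod.hasSum
  rw [hsum.prod_symm.tsum_prod.symm] at h
  simp only [Prod.swap_prod_mk, Prod.fst_swap, Prod.snd_swap, hcol] at h
  have heq : ∑' k, p t i k * (k * x ^ (k - 1) * B b x)
      = ∑' z : ℕ × ℕ, p t i z.2 * qMatrix b z.2 z.1 * x ^ z.1 := by
    rw [← tsum_congr hrow, ← hsum.tsum_prod]
    exact ((Equiv.prodComm ℕ ℕ).tsum_eq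
      (fun z : ℕ × ℕ => p t i z.1 * qMatrix b z.1 z.2 * x ^ z.2)).symm
  rw [heq]
  exact h

/-- The branching property, for generating functions: the one with `i` ancestors is the `i`-th power
of the solution of the backward equation. -/
theorem IsBranchingTransition.hasSum_mul_pow (hb : IsBranchingRate b)
    (hp : IsBranchingTransition b p) {u : ℝ} (hu : u ∈ Ico (0 : ℝ) 1) {y : ℝ → ℝ}
    (hy : IsSolution b u 1 y) {t : ℝ} (ht : 0 ≤ t) (i : ℕ) :
    HasSum (fun j => p t i j * u ^ j) (y t ^ i) := by
  have hc := hb.pos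
  have hv1 : (1 : ℝ) ∈ Icc (0 : ℝ) 1 := ⟨zero_le_one, le_rfl⟩
  have hb0 := hb.nonneg 0 (by norm_num)
  have hΦt : ∑' j, p t i j * y 0 ^ j = y t ^ i ∧ Summable fun j => p t i j * y 0 ^ j := by
    refine ⟨?_, hp.summable_mul_of_le ht i (C := 1) fun j => ?_⟩
    swap
    · rw [abs_pow, abs_of_nonneg (hy.mem 0 le_rfl).1]
      exact pow_le_one₀ (hy.mem 0 le_rfl).1 (hy.mem 0 le_rfl).2
    have h0 : ∑' j, p (t - t) i j * y t ^ j = y t ^ i := by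
      rw [sub_self, tsum_eq_single i fun j hj => by rw [hp.zero, if_neg hj.symm, zero_mul], hp.zero,
        if_pos rfl, one_mul]
    rcases ht.eq_or_lt with rfl | hpos
    · simpa using h0
    set r := barrier (b 0) u t with hr
    have hr0 : 0 ≤ r := hu.1.trans (MBP.le_barrier hb0 hu.2 t ht)
    have hr1 : r < 1 := barrier_lt_one hu.2 _ _
    have hyr : ∀ s ∈ Icc 0 t, y s ∈ Icc 0 r := fun s hs => ⟨(hy.mem s hs.1).1,
      (hy.le_barrier hb hv1 hu.2 le_rfl hs.1).trans (barrier_mono hb0 hu.2.le hs.2)⟩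
    have hpow : ∀ s ∈ Icc 0 t, ∀ j : ℕ, y s ^ j ≤ r ^ j := fun s hs j =>
      pow_le_pow_left₀ (hyr s hs).1 (hyr s hs).2 j
    have hS : ∀ s ∈ Icc 0 t, ∀ j, ‖p (t - s) i j * y s ^ j‖ ≤ r ^ j := fun s hs j => by
      rw [norm_mul, norm_pow, Real.norm_of_nonneg (hyr s hs).1,
        Real.norm_of_nonneg (hp.nonneg _ (sub_nonneg.2 hs.2) i j)]
      exact (mul_le_of_le_one_left (pow_nonneg (hyr s hs).1 j)
        (hp.le_one (sub_nonneg.2 hs.2) i j)).trans (hpow s hs j)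
    have hsub : ∀ s ∈ Ioo 0 t, HasDerivAt (fun s => t - s) (-1) s := fun s _ => by
      simpa using (hasDerivAt_id s).const_sub t
    -- This function of `s` joins the generating function at time `t` (`s = 0`) to `y t ^ i` (`s =
    -- t`); it is shown to be constant.
    have hcont : ContinuousOn (fun s => ∑' j, p (t - s) i j * y s ^ j) (Icc 0 t) := by
      refine continuousOn_tsum (fun j => ?_) (summable_geometric_of_lt_one hr0 hr1)
        fun j s hs => hS s hs j
      refine ContinuousOn.mul ((hp.continuousOn i j).comp (by fun_prop) fun s hs => ?_)
        ((hy.continuousOn.mono Icc_subset_Ici_self).pow j)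
      exact sub_nonneg.2 hs.2
    have hterm : ∀ j, ∀ s ∈ Ioo 0 t, HasDerivAt (fun s => p (t - s) i j * y s ^ j)
        (p (t - s) i j * (j * y s ^ (j - 1) * B b (y s))
          - (∑' k, p (t - s) i k * qMatrix b k j) * y s ^ j) s := fun j s hs => by
      have h₁ := ((hp.forward (t - s) (sub_nonneg.2 hs.2.le) i j).hasDerivAt
        (Ici_mem_nhds (sub_pos.2 hs.2))).scomp s (hsub s hs)
      have h₂ := ((hy.deriv s hs.1.le).hasDerivAt (Ici_mem_nhds hs.1)).pow j
      refine (h₁.mul h₂).congr_deriv ?_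
      simp
      ring
    have hbound : ∀ j, ∀ s ∈ Ioo 0 t, ‖p (t - s) i j * (j * y s ^ (j - 1) * B b (y s))
        - (∑' k, p (t - s) i k * qMatrix b k j) * y s ^ j‖
        ≤ 2 * -b 1 * (j * r ^ (j - 1)) + (j + 1) * -b 1 * r ^ j := fun j s hs => by
      have hs' := Ioo_subset_Icc_self hs
      have hts := sub_nonneg.2 hs.2.le
      have hB := hb.abs_B_le (hy.mem s hs.1.le)
      refine (norm_sub_le _ _).trans (add_le_add ?_ ?_)
      · rw [norm_mul, norm_mul, norm_mul, norm_pow, Real.norm_of_nonneg (hyr s hs').1,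
          Real.norm_of_nonneg (hp.nonneg _ hts i j), Real.norm_natCast, Real.norm_eq_abs]
        have h₁ : (j : ℝ) * y s ^ (j - 1) * |B b (y s)| ≤ j * r ^ (j - 1) * (2 * -b 1) :=
          mul_le_mul (mul_le_mul_of_nonneg_left (hpow s hs' _) (by positivity)) hB (abs_nonneg _)
            (by positivity)
        refine (mul_le_of_le_one_left ?_ (hp.le_one hts i j)).trans (h₁.trans_eq (by ring))
        exact mul_nonneg (mul_nonneg (by positivity) (pow_nonneg (hyr s hs').1 _)) (abs_nonneg _)
      · rw [norm_mul, norm_pow, Real.norm_of_nonneg (hyr s hs').1]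
        exact mul_le_mul (hp.abs_deriv_le hb hts i j) (hpow s hs' j) (pow_nonneg (hyr s hs').1 _)
          (by positivity)
    have hmaj : Summable fun j : ℕ => 2 * -b 1 * (j * r ^ (j - 1)) + (j + 1) * -b 1 * r ^ j := by
      refine ((summable_natCast_mul_pow_pred hr0 hr1).mul_left _).add ?_
      have h := ((summable_pow_mul_geometric_of_norm_lt_one 1
        (by rwa [Real.norm_of_nonneg hr0] : ‖r‖ < 1)).add
        (summable_geometric_of_lt_one hr0 hr1)).mul_left (-b 1)
      exact h.congr fun j => by ring
    have hderiv : ∀ s ∈ Ioo 0 t, HasDerivAt (fun s => ∑' j, p (t - s) i j * y s ^ j) 0 s :=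
      fun s hs => by
        have hts := sub_nonneg.2 hs.2.le
        have h := hasDerivAt_tsum_of_isPreconnected hmaj isOpen_Ioo isPreconnected_Ioo hterm hbound
          hs (Summable.of_norm_bounded (summable_geometric_of_lt_one hr0 hr1)
            (hS s (Ioo_subset_Icc_self hs))) hs
        refine h.congr_deriv ?_
        -- The forward equation evaluated at `x = y s` cancels the chain-rule term, because `y' =
        -- B(y)` when `v = 1`.
        have hys : y s ∈ Ico (0 : ℝ) 1 := ⟨(hy.mem s hs.1.le).1, hy.lt_one hb hv1 hu.2 hs.1.le⟩
        have h₁ := hp.hasSum_deriv_mul_pow hb hts i hys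
        have h₂ := hmaj.of_norm_bounded_eventually_nat
          (f := fun j => p (t - s) i j * (j * y s ^ (j - 1) * B b (y s))
            - (∑' k, p (t - s) i k * qMatrix b k j) * y s ^ j)
          (Eventually.of_forall fun j => hbound j s hs)
        have h₃ : Summable fun j : ℕ => p (t - s) i j * (j * y s ^ (j - 1) * B b (y s)) := by
          simpa using h₂.add h₁.summable
        rw [h₃.tsum_sub h₁.summable, h₁.tsum_eq, sub_self]
    obtain ⟨s, hs, hslope⟩ := exists_hasDerivAt_eq_slope _ (fun _ => 0) hpos hcont hderiv
    rw [eq_comm, div_eq_zero_iff, or_iff_left (by linarith), h0, sub_zero] at hslope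
    linarith
  rw [← hy.init, ← hΦt.1]
  exact hΦt.2.hasSum

end Forward

/-! ### The generating function over one short time step. -/

section Step

variable {b : ℕ → ℝ} {p : ℝ → ℕ → ℕ → ℝ}

/-- The weight of a transition from `i` to `j` in the generating function of the death number. -/
def deathWeight (v : ℝ) (i j : ℕ) : ℝ := if j + 1 = i then v else 1

theorem abs_deathWeight_le {v : ℝ} (hv : v ∈ Icc (0 : ℝ) 1) (i j : ℕ) :
    |deathWeight v i j| ≤ 1 := by
  unfold deathWeight
  split_ifs
  · rw [abs_of_nonneg hv.1]; exact hv.2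
  · rw [abs_one]

/-- Geometric decay beats the quadratic growth in the number of ancestors; this is what makes the
step estimate uniform. -/
theorem exists_bound_natCast_mul_pow {r : ℝ} (h0 : 0 ≤ r) (h1 : r < 1) :
    ∃ A, 0 ≤ A ∧ ∀ m : ℕ, (m + 1 : ℝ) * (m + 2) * r ^ (m - 1) ≤ A := by
  have hr : ‖r‖ < 1 := by rwa [Real.norm_of_nonneg h0]
  have hs : Summable fun m : ℕ => (m + 1 : ℝ) * (m + 2) * r ^ (m - 1) := by
    rw [← summable_nat_add_iff 1]
    have h := ((summable_pow_mul_geometric_of_norm_lt_one 2 hr).add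
      ((summable_pow_mul_geometric_of_norm_lt_one 1 hr).mul_left 5)).add
      ((summable_geometric_of_lt_one h0 h1).mul_left 6)
    refine h.congr fun m => ?_
    simp
    ring
  exact ⟨_, tsum_nonneg fun m => by positivity, fun m => hs.le_tsum m fun j _ => by positivity⟩

/-- The diagonal term `k = m + 1` carries exactly the rate `(m + 1) * b 0`. By honesty this rate can
be averaged over `k` too, so the difference only sees the mass off the diagonal, which is `O(t)`. -/
theorem IsBranchingTransition.abs_deriv_sub_le (hb : IsBranchingRate b)
    (hp : IsBranchingTransition b p) {t : ℝ} (ht : 0 ≤ t) (m : ℕ) :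
    |∑' k, p t (m + 1) k * qMatrix b k m - (m + 1) * b 0|
      ≤ 2 * (-b 1) ^ 2 * ((m + 1) * (m + 2)) * t := by
  have hc := hb.pos
  have h₁ := (hp.summable_mul_of_le ht (m + 1) fun k => hb.abs_qMatrix_le k m).hasSum.sub
    ((hp.honest t ht (m + 1)).mul_right ((m + 1) * b 0))
  have h₂ := ((hp.honest t ht (m + 1)).sub
    (hasSum_ite_eq (m + 1) (p t (m + 1) (m + 1)))).mul_right (2 * ((m + 1) * -b 1))
  rw [one_mul] at h₁
  rw [← h₁.tsum_eq]
  have hd := hp.one_sub_diag_le hb ht (m + 1)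
  refine (tsum_of_norm_bounded
    (f := fun k => p t (m + 1) k * qMatrix b k m - p t (m + 1) k * ((m + 1) * b 0)) h₂
    fun k => ?_).trans ?_
  · rw [← mul_sub, norm_mul, Real.norm_of_nonneg (hp.nonneg t ht _ k)]
    split_ifs with hk
    · subst hk
      simp [qMatrix]
    · rw [sub_zero]
      refine mul_le_mul_of_nonneg_left ((norm_sub_le _ _).trans ?_) (hp.nonneg t ht _ k)
      rw [two_mul]
      refine add_le_add (hb.abs_qMatrix_le k m) ?_
      rw [norm_mul, Real.norm_of_nonneg (by positivity : (0 : ℝ) ≤ m + 1)]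
      exact mul_le_mul_of_nonneg_left (hb.abs_le 0) (by positivity)
  · push_cast at hd
    calc (1 - p t (m + 1) (m + 1)) * (2 * ((m + 1) * -b 1))
        ≤ ((m + 1 + 1) * -b 1 * t) * (2 * ((m + 1) * -b 1)) :=
          mul_le_mul_of_nonneg_right hd (by positivity)
      _ = _ := by ring

theorem IsBranchingTransition.hasSum_deathWeight (hb : IsBranchingRate b)
    (hp : IsBranchingTransition b p) {u : ℝ} (hu : u ∈ Ico (0 : ℝ) 1) (v : ℝ) {y : ℝ → ℝ}
    (hy : IsSolution b u 1 y) {t : ℝ} (ht : 0 ≤ t) (m : ℕ) :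
    HasSum (fun j => p t (m + 1) j * (deathWeight v (m + 1) j * u ^ j))
      (y t ^ (m + 1) - (1 - v) * (p t (m + 1) m * u ^ m)) := by
  refine ((hp.hasSum_mul_pow hb hu hy ht (m + 1)).sub
    (hasSum_ite_eq m ((1 - v) * (p t (m + 1) m * u ^ m)))).congr_fun fun j => ?_
  unfold deathWeight
  rcases eq_or_ne j m with rfl | h
  · simp
    ring
  · simp [h]

/-- A one-step estimate that is uniform in the number of ancestors. -/
theorem IsBranchingTransition.exists_step_bound (hb : IsBranchingRate b)
    (hp : IsBranchingTransition b p) {v : ℝ} (hv : v ∈ Icc (0 : ℝ) 1) {r : ℝ} (h0 : 0 ≤ r)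
    (h1 : r < 1) : ∃ C, 0 ≤ C ∧ ∀ u y z, IsSolution b u 1 y → IsSolution b u v z →
      ∀ h, 0 ≤ h → (∀ s ∈ Icc 0 h, y s ≤ r ∧ z s ≤ r) →
      ∀ i, |∑' j, p h i j * (deathWeight v i j * u ^ j) - z h ^ i| ≤ C * h * h := by
  have hc := hb.pos
  obtain ⟨K, hK, hL⟩ := hb.exists_lipschitz_B h0 h1
  obtain ⟨A, hA, hbound⟩ := exists_bound_natCast_mul_pow h0 h1
  have hv1 : (1 : ℝ) ∈ Icc (0 : ℝ) 1 := ⟨zero_le_one, le_rfl⟩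
  -- The three summands are the constants in `e₁`, `e₂`, `e₃` below; the factor `6 = 3 + 3` comes
  -- from comparing `y` and `z` through their common initial value.
  refine ⟨A * (2 * -b 1 + K) * (6 * -b 1) + 3 * (-b 1) ^ 2 * A + 2 * (-b 1) ^ 2 * A,
    by positivity, fun u y z hy hz h hh hr i => ?_⟩
  set C := A * (2 * -b 1 + K) * (6 * -b 1) + 3 * (-b 1) ^ 2 * A + 2 * (-b 1) ^ 2 * A with hC
  have hC0 : 0 ≤ C := by positivity
  have hu : u ∈ Icc 0 r := by
    rw [← hy.init]
    exact ⟨(hy.mem 0 le_rfl).1, (hr 0 ⟨le_rfl, hh⟩).1⟩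
  have hu1 : u ∈ Ico (0 : ℝ) 1 := ⟨hu.1, hu.2.trans_lt h1⟩
  rcases i with _ | m
  · have h' := hp.hasSum_mul_pow hb hu1 hy hh 0
    have : ∑' j, p h 0 j * (deathWeight v 0 j * u ^ j) = 1 := by
      simpa [deathWeight] using h'.tsum_eq
    rw [this]
    simp
    positivity
  · rw [(hp.hasSum_deathWeight hb hu1 v hy hh m).tsum_eq]
    set e : ℝ → ℝ := fun s => y s ^ (m + 1) - (1 - v) * (p s (m + 1) m * u ^ m) - z s ^ (m + 1)
    have hm2 : (m + 1 : ℝ) * (m + 2) * r ^ m ≤ A := by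
      refine le_trans ?_ (hbound m)
      refine mul_le_mul_of_nonneg_left ?_ (by positivity)
      exact pow_le_pow_of_le_one h0 h1.le (Nat.sub_le m 1)
    have hm1 : (m + 1 : ℝ) * r ^ m ≤ A := by
      refine le_trans ?_ hm2
      have : 0 ≤ (m + 1 : ℝ) * r ^ m := by positivity
      nlinarith [(Nat.cast_nonneg m : (0 : ℝ) ≤ m)]
    have hm0 : (m + 1 : ℝ) * (m * r ^ (m - 1)) ≤ A := by
      refine le_trans ?_ (hbound m)
      rw [mul_assoc]
      gcongr
      linarith
    have hpowsub : ∀ x ∈ Icc 0 r, ∀ w ∈ Icc 0 r, (m + 1 : ℝ) * |x ^ m - w ^ m| ≤ A * |x - w| :=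
      fun x hx w hw => by
        calc (m + 1 : ℝ) * |x ^ m - w ^ m| ≤ (m + 1) * (m * r ^ (m - 1) * |x - w|) :=
              mul_le_mul_of_nonneg_left (abs_pow_sub_pow_le_of_mem_Icc hx hw m) (by positivity)
          _ = ((m + 1) * (m * r ^ (m - 1))) * |x - w| := by ring
          _ ≤ _ := mul_le_mul_of_nonneg_right hm0 (abs_nonneg _)
    -- Adding and subtracting `b 0 * (1 - v) * (m + 1) * u ^ m` groups the derivative into three
    -- differences, each `O(s)`: the extra drift of `z` cancels the rate of the weighted death to
    -- leading order. As `e 0 = 0`, integrating gives `O(h²)`.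
    have hderiv : ∀ s ∈ Icc 0 h, HasDerivWithinAt e
        (((m + 1) * y s ^ m * B b (y s) - (m + 1) * z s ^ m * B b (z s))
          + b 0 * (1 - v) * ((m + 1) * (z s ^ m - u ^ m))
          - (1 - v) * (u ^ m * (∑' k, p s (m + 1) k * qMatrix b k m - (m + 1) * b 0)))
        (Icc 0 h) s := fun s hs => by
      have h₁ := ((hy.deriv s hs.1).mono (s := Icc 0 h) Icc_subset_Ici_self).fun_pow (m + 1)
      have h₂ := ((hz.deriv s hs.1).mono (s := Icc 0 h) Icc_subset_Ici_self).fun_pow (m + 1)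
      have h₃ := (((hp.forward s hs.1 (m + 1) m).mono (s := Icc 0 h)
        Icc_subset_Ici_self).mul_const (u ^ m)).const_mul (1 - v)
      refine ((h₁.fun_sub h₃).fun_sub h₂).congr_deriv ?_
      push_cast
      ring
    have hnorm : ∀ s ∈ Icc 0 h,
        ‖((m + 1) * y s ^ m * B b (y s) - (m + 1) * z s ^ m * B b (z s))
          + b 0 * (1 - v) * ((m + 1) * (z s ^ m - u ^ m))
          - (1 - v) * (u ^ m * (∑' k, p s (m + 1) k * qMatrix b k m - (m + 1) * b 0))‖
        ≤ C * h := fun s hs => by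
      have hys : y s ∈ Icc 0 r := ⟨(hy.mem s hs.1).1, (hr s hs).1⟩
      have hzs : z s ∈ Icc 0 r := ⟨(hz.mem s hs.1).1, (hr s hs).2⟩
      have hyu : |y s - u| ≤ 3 * -b 1 * s := by
        simpa [hy.init, abs_of_nonneg hs.1] using hy.abs_sub_le hb hv1 le_rfl hs.1
      have hzu : |z s - u| ≤ 3 * -b 1 * s := by
        simpa [hz.init, abs_of_nonneg hs.1] using hz.abs_sub_le hb hv le_rfl hs.1
      have hyz : |y s - z s| ≤ 6 * -b 1 * s := by
        have := abs_sub_le (y s) u (z s)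
        rw [abs_sub_comm u] at this
        linarith
      have e₁ : |(m + 1) * y s ^ m * B b (y s) - (m + 1) * z s ^ m * B b (z s)|
          ≤ A * (2 * -b 1 + K) * (6 * -b 1) * s := by
        have hsplit : (m + 1) * y s ^ m * B b (y s) - (m + 1) * z s ^ m * B b (z s)
            = (m + 1) * (y s ^ m - z s ^ m) * B b (y s)
              + (m + 1) * z s ^ m * (B b (y s) - B b (z s)) := by ring
        rw [hsplit]
        have i₁ : |(m + 1) * (y s ^ m - z s ^ m) * B b (y s)|
            ≤ A * |y s - z s| * (2 * -b 1) := by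
          rw [abs_mul, abs_mul, abs_of_nonneg (by positivity : (0 : ℝ) ≤ m + 1)]
          exact mul_le_mul (hpowsub _ hys _ hzs) (hb.abs_B_le (hy.mem s hs.1)) (abs_nonneg _)
            (by positivity)
        have i₂ : |(m + 1) * z s ^ m * (B b (y s) - B b (z s))| ≤ A * (K * |y s - z s|) := by
          rw [abs_mul, abs_of_nonneg (mul_nonneg (by positivity) (pow_nonneg hzs.1 m))]
          refine mul_le_mul (le_trans ?_ hm1) (hL _ hys _ hzs) (abs_nonneg _) hA
          exact mul_le_mul_of_nonneg_left (pow_le_pow_left₀ hzs.1 hzs.2 m) (by positivity)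
        calc _ ≤ A * |y s - z s| * (2 * -b 1) + A * (K * |y s - z s|) :=
              (abs_add_le _ _).trans (add_le_add i₁ i₂)
          _ = A * (2 * -b 1 + K) * |y s - z s| := by ring
          _ ≤ A * (2 * -b 1 + K) * (6 * -b 1 * s) :=
              mul_le_mul_of_nonneg_left hyz (by positivity)
          _ = _ := by ring
      have hv' : |1 - v| ≤ 1 := by rw [abs_le]; constructor <;> linarith [hv.1, hv.2]
      have e₂ : |b 0 * (1 - v) * ((m + 1) * (z s ^ m - u ^ m))| ≤ 3 * (-b 1) ^ 2 * A * s := by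
        rw [abs_mul, abs_mul, abs_mul, abs_of_nonneg (by positivity : (0 : ℝ) ≤ m + 1)]
        calc |b 0| * |1 - v| * ((m + 1) * |z s ^ m - u ^ m|)
            ≤ (-b 1 * 1) * (A * (3 * -b 1 * s)) := by
              refine mul_le_mul (mul_le_mul (hb.abs_le 0) hv' (abs_nonneg _) hc.le)
                ((hpowsub _ hzs _ hu).trans (mul_le_mul_of_nonneg_left hzu hA)) ?_ (by positivity)
              exact mul_nonneg (by positivity) (abs_nonneg _)
          _ = _ := by ring
      have e₃ : |(1 - v) * (u ^ m * (∑' k, p s (m + 1) k * qMatrix b k m - (m + 1) * b 0))|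
          ≤ 2 * (-b 1) ^ 2 * A * s := by
        rw [abs_mul, abs_mul, abs_of_nonneg (pow_nonneg hu.1 m)]
        calc |1 - v| * (u ^ m * |∑' k, p s (m + 1) k * qMatrix b k m - (m + 1) * b 0|)
            ≤ 1 * (r ^ m * (2 * (-b 1) ^ 2 * ((m + 1) * (m + 2)) * s)) := by
              refine mul_le_mul hv' (mul_le_mul (pow_le_pow_left₀ hu.1 hu.2 m)
                (hp.abs_deriv_sub_le hb hs.1 m) (abs_nonneg _) (by positivity)) ?_ zero_le_one
              exact mul_nonneg (pow_nonneg hu.1 m) (abs_nonneg _)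
          _ = 2 * (-b 1) ^ 2 * s * ((m + 1) * (m + 2) * r ^ m) := by ring
          _ ≤ 2 * (-b 1) ^ 2 * s * A :=
              mul_le_mul_of_nonneg_left hm2 (mul_nonneg (by positivity) hs.1)
          _ = _ := by ring
      calc _ ≤ A * (2 * -b 1 + K) * (6 * -b 1) * s + 3 * (-b 1) ^ 2 * A * s
              + 2 * (-b 1) ^ 2 * A * s :=
            (norm_sub_le _ _).trans (add_le_add ((norm_add_le _ _).trans (add_le_add e₁ e₂)) e₃)
        _ = C * s := by rw [hC]; ring
        _ ≤ C * h := mul_le_mul_of_nonneg_left hs.2 hC0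
    have key := (convex_Icc (0 : ℝ) h).norm_image_sub_le_of_norm_hasDerivWithin_le hderiv hnorm
      (left_mem_Icc.2 hh) (right_mem_Icc.2 hh)
    have he0 : e 0 = 0 := by simp [e, hy.init, hz.init, hp.zero]
    rwa [he0, sub_zero, sub_zero, Real.norm_of_nonneg hh] at key

end Step

/-! ### Counting down-crossings of a step path along a grid. -/

section Paths

/-- The times in `(s, t]` at which the path `x` jumps down by one. -/
def downCrossings (x : ℝ≥0 → ℕ) (s t : ℝ≥0) : Set ℝ≥0 :=
  {r | s < r ∧ r ≤ t ∧ ∀ᶠ q in 𝓝[<] r, x q = x r + 1}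

theorem downCrossings_self (x : ℝ≥0 → ℕ) (s : ℝ≥0) : downCrossings x s s = ∅ :=
  eq_empty_of_forall_notMem fun _ hr => (hr.1.trans_le hr.2.1).false

theorem downCrossings_union (x : ℝ≥0 → ℕ) {s t w : ℝ≥0} (hst : s ≤ t) (htw : t ≤ w) :
    downCrossings x s w = downCrossings x s t ∪ downCrossings x t w := by
  ext r
  constructor
  · rintro ⟨h₁, h₂, h₃⟩
    rcases le_or_gt r t with h | h
    · exact Or.inl ⟨h₁, h, h₃⟩
    · exact Or.inr ⟨h, h₂, h₃⟩
  · rintro (⟨h₁, h₂, h₃⟩ | ⟨h₁, h₂, h₃⟩)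
    · exact ⟨h₁, h₂.trans htw, h₃⟩
    · exact ⟨hst.trans_lt h₁, h₂, h₃⟩

theorem disjoint_downCrossings (x : ℝ≥0 → ℕ) (s t w : ℝ≥0) :
    Disjoint (downCrossings x s t) (downCrossings x t w) :=
  disjoint_left.2 fun _ h₁ h₂ => (h₁.2.1.trans_lt h₂.1).false

/-- An interval on which the path has at most one jump. -/
theorem downCrossings_of_single_jump {x : ℝ≥0 → ℕ} {s t a : ℝ≥0} {k : ℕ} (hst : s ≤ t)
    (hx : ∀ r ∈ Icc s t, (a ≤ r → x r = x a) ∧ (r < a → x r = k)) :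
    downCrossings x s t = if x t + 1 = x s then {a} else ∅ := by
  have hleft : ∀ r ∈ Ioc s t, r ≠ a → ∀ᶠ q in 𝓝[<] r, x q = x r := by
    intro r hr hra
    rcases hra.lt_or_gt with h | h
    · filter_upwards [Ioo_mem_nhdsLT hr.1] with q hq
      rw [(hx q ⟨hq.1.le, hq.2.le.trans hr.2⟩).2 (hq.2.trans h), (hx r ⟨hr.1.le, hr.2⟩).2 h]
    · filter_upwards [Ioo_mem_nhdsLT hr.1, Ioo_mem_nhdsLT h] with q hq hq'
      rw [(hx q ⟨hq.1.le, hq.2.le.trans hr.2⟩).1 hq'.1.le, (hx r ⟨hr.1.le, hr.2⟩).1 h.le]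
  have hne : ∀ r ∈ downCrossings x s t, r = a := by
    intro r hr
    by_contra hra
    have : (𝓝[<] r).NeBot := nhdsLT_neBot_of_exists_lt ⟨s, hr.1⟩
    obtain ⟨q, h₁, h₂⟩ := ((hleft r ⟨hr.1, hr.2.1⟩ hra).and hr.2.2).exists
    omega
  have hmem : a ∈ downCrossings x s t ↔ x t + 1 = x s := by
    -- The point `a` may lie outside `(s, t]`; then the path is constant on `[s, t]` and both sides
    -- are false.
    rcases le_or_gt a s with has | has
    · refine iff_of_false (fun h => (has.trans_lt h.1).false) ?_
      rw [(hx t ⟨hst, le_rfl⟩).1 (has.trans hst), (hx s ⟨le_rfl, hst⟩).1 has]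
      omega
    rcases lt_or_ge t a with hta | hta
    · refine iff_of_false (fun h => (hta.trans_le h.2.1).false) ?_
      rw [(hx t ⟨hst, le_rfl⟩).2 hta, (hx s ⟨le_rfl, hst⟩).2 has]
      omega
    have hk : ∀ᶠ q in 𝓝[<] a, x q = k := by
      filter_upwards [Ioo_mem_nhdsLT has] with q hq
      exact (hx q ⟨hq.1.le, hq.2.le.trans hta⟩).2 hq.2
    have : (𝓝[<] a).NeBot := nhdsLT_neBot_of_exists_lt ⟨s, has⟩
    rw [(hx t ⟨hst, le_rfl⟩).1 hta, (hx s ⟨le_rfl, hst⟩).2 has]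
    constructor
    · rintro ⟨-, -, h⟩
      obtain ⟨q, h₁, h₂⟩ := (hk.and h).exists
      omega
    · exact fun h => ⟨has, hta, hk.mono fun q hq => by omega⟩
  split_ifs with h
  · exact Subset.antisymm hne (singleton_subset_iff.2 (hmem.2 h))
  · exact eq_empty_of_forall_notMem fun r hr => h (hmem.1 (hne r hr ▸ hr))

/-- Every time has a neighbourhood in which only that time can be a jump. A Lebesgue number of this
cover of the compact `[0, T]` is the required mesh. -/
theorem IsStepPath.exists_mesh {x : ℝ≥0 → ℕ} (hx : IsStepPath x) (T : ℝ≥0) :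
    ∃ δ > 0, ∀ s t, s ≤ t → t ≤ T → dist t s < δ →
      ∃ a, downCrossings x s t = if x t + 1 = x s then {a} else ∅ := by
  have hloc : ∀ a, ∃ U, IsOpen U ∧ a ∈ U ∧
      ∃ k, ∀ r ∈ U, (a ≤ r → x r = x a) ∧ (r < a → x r = k) := by
    intro a
    obtain ⟨h₁, k, h₂⟩ := hx a
    rw [eventually_nhdsWithin_iff] at h₁ h₂
    obtain ⟨U, hU, hUo, ha⟩ := eventually_nhds_iff.1 (h₁.and h₂)
    refine ⟨U, hUo, ha, k, fun r hr => ⟨fun har => ?_, fun hra => (hU r hr).2 hra⟩⟩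
    rcases har.eq_or_lt with rfl | h
    · rfl
    · exact (hU r hr).1 h
  choose U hUo hUa hU using hloc
  obtain ⟨δ, hδ, hball⟩ := lebesgue_number_lemma_of_metric (isCompact_Icc (a := (0 : ℝ≥0)) (b := T))
    hUo fun a _ => mem_iUnion.2 ⟨a, hUa a⟩
  refine ⟨δ, hδ, fun s t hst htT hd => ?_⟩
  obtain ⟨a, ha⟩ := hball s ⟨zero_le, hst.trans htT⟩
  obtain ⟨k, hk⟩ := hU a
  refine ⟨a, downCrossings_of_single_jump hst fun r hr => hk r (ha ?_)⟩
  rw [Metric.mem_ball]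
  refine lt_of_le_of_lt ?_ hd
  rw [NNReal.dist_eq, NNReal.dist_eq, abs_of_nonneg (sub_nonneg.2 (by exact_mod_cast hr.1)),
    abs_of_nonneg (sub_nonneg.2 (by exact_mod_cast hst))]
  exact sub_le_sub_right (by exact_mod_cast hr.2) _

/-- The number of decrements by one of the sequence `i` up to time `n`. -/
def decrements (i : ℕ → ℕ) (n : ℕ) : ℕ :=
  ∑ k ∈ Finset.range n, if i (k + 1) + 1 = i k then 1 else 0

/-- The points of the partition of `[0, t]` into `n + 1` intervals of equal length. -/
noncomputable def grid (t : ℝ≥0) (n k : ℕ) : ℝ≥0 := k * (t / (n + 1))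

theorem grid_monotone (t : ℝ≥0) (n : ℕ) : Monotone (grid t n) := fun _ _ h => by
  unfold grid
  gcongr

theorem grid_zero (t : ℝ≥0) (n : ℕ) : grid t n 0 = 0 := by simp [grid]

theorem grid_last (t : ℝ≥0) (n : ℕ) : grid t n (n + 1) = t := by
  unfold grid
  push_cast
  exact mul_div_cancel₀ t (by positivity)

theorem grid_succ_sub (t : ℝ≥0) (n k : ℕ) :
    (grid t n (k + 1) : ℝ) - grid t n k = t / (n + 1) := by
  unfold grid
  push_cast
  ring

theorem IsStepPath.eventually_decrements_eq {x : ℝ≥0 → ℕ} (hx : IsStepPath x) (t : ℝ≥0) :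
    ∀ᶠ n in atTop,
      decrements (fun k => x (grid t n k)) (n + 1) = (downCrossings x 0 t).ncard := by
  obtain ⟨δ, hδ, hmesh⟩ := hx.exists_mesh t
  have hlim : Tendsto (fun n : ℕ => (t : ℝ) / (n + 1)) atTop (𝓝 0) :=
    tendsto_const_div_atTop_nhds_zero_nat (t : ℝ) |>.comp (tendsto_add_atTop_nat 1) |>.congr
      fun n => by simp
  filter_upwards [hlim.eventually_lt_const hδ] with n hn
  have key : ∀ m ≤ n + 1, (downCrossings x 0 (grid t n m)).Finite ∧
      (downCrossings x 0 (grid t n m)).ncard = decrements (fun k => x (grid t n k)) m := by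
    intro m
    induction m with
    | zero => intro _; simp [grid_zero, downCrossings_self, decrements]
    | succ m ih =>
      intro hm
      obtain ⟨hfin, hcard⟩ := ih (by omega)
      have hle : grid t n m ≤ grid t n (m + 1) := grid_monotone t n (Nat.le_succ m)
      obtain ⟨a, ha⟩ := hmesh _ _ hle ((grid_monotone t n hm).trans_eq (grid_last t n)) (by
        rw [NNReal.dist_eq, grid_succ_sub, abs_of_nonneg (by positivity)]
        exact hn)
      have hfin' : (downCrossings x (grid t n m) (grid t n (m + 1))).Finite := by
        rw [ha]; split_ifs <;> simp
      rw [downCrossings_union x zero_le hle]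
      refine ⟨hfin.union hfin', ?_⟩
      rw [ncard_union_eq (disjoint_downCrossings x _ _ _) hfin hfin', hcard, ha, decrements,
        decrements, Finset.sum_range_succ]
      split_ifs <;> simp
  rw [← (key (n + 1) le_rfl).2, grid_last]

end Paths

/-! ### The joint generating function of death number and population size. -/

section BranchingProcess

variable {Ω : Type*} [MeasurableSpace Ω] {μ : Measure Ω}
  {b : ℕ → ℝ} {p : ℝ → ℕ → ℕ → ℝ} {X : ℝ≥0 → Ω → ℕ}

theorem hasSum_measureReal_singleton_mul {S : Type*} [MeasurableSpace S] [Countable S]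
    [MeasurableSingletonClass S] (ν : Measure S) [IsFiniteMeasure ν] {F : S → ℝ} {C : ℝ}
    (hF : ∀ x, |F x| ≤ C) : HasSum (fun x => ν.real {x} * F x) (∫ x, F x ∂ν) := by
  have hint : Integrable F ν :=
    Integrable.of_bound (Measurable.of_discrete (f := F)).aestronglyMeasurable C
      (Eventually.of_forall hF)
  rw [← Measure.sum_smul_dirac ν] at hint
  have h := hasSum_integral_measure hint
  rw [Measure.sum_smul_dirac ν] at h
  refine h.congr_fun fun x => ?_
  rw [integral_smul_measure, integral_dirac, smul_eq_mul, measureReal_def]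

/-- The Markov property, conditioning on the path at the times `τ 0, …, τ n`. -/
theorem IsMarkovChain.integral_mul [IsProbabilityMeasure μ]
    (hp : IsTransitionFunction p) (hX : IsMarkovChain p X μ)
    {τ : ℕ → ℝ≥0} (hτ : Monotone τ) (n : ℕ) {g : (ℕ → ℕ) → ℝ}
    (hgn : ∀ i i' : ℕ → ℕ, (∀ k ≤ n, i k = i' k) → g i = g i') (hg : ∀ i, |g i| ≤ 1)
    {f : ℕ → ℕ → ℝ} (hf : ∀ i j, |f i j| ≤ 1) :
    ∫ ω, g (fun k => X (τ k) ω) * f (X (τ n) ω) (X (τ (n + 1)) ω) ∂μ =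
      ∫ ω, g (fun k => X (τ k) ω) *
        ∑' j, p ((τ (n + 1) : ℝ) - τ n) (X (τ n) ω) j * f (X (τ n) ω) j ∂μ := by
  set h : ℝ := (τ (n + 1) : ℝ) - τ n with hh
  have hh0 : 0 ≤ h := sub_nonneg.2 (by exact_mod_cast hτ (Nat.le_succ n))
  set π : Ω → Fin (n + 1) → ℕ := fun ω k => X (τ k) ω with hπ
  have hπm : Measurable π := measurable_pi_lambda _ fun k => hX.measurable _
  have hψm : Measurable fun ω => (π ω, X (τ (n + 1)) ω) := hπm.prodMk (hX.measurable _)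
  -- Freezing a finite history after index `n` turns it into a sequence to which `g` applies, while
  -- laws live on the countable space `Fin (n + 1) → ℕ`.
  set ext : (Fin (n + 1) → ℕ) → ℕ → ℕ := fun x k => x ⟨min k n, by omega⟩ with hext
  have hgπ : ∀ ω, g (fun k => X (τ k) ω) = g (ext (π ω)) := fun ω =>
    hgn _ _ fun k hk => by simp [hext, hπ, min_eq_left hk]
  set F : (Fin (n + 1) → ℕ) × ℕ → ℝ := fun z => g (ext z.1) * f (z.1 (Fin.last n)) z.2 with hF
  set H : (Fin (n + 1) → ℕ) → ℝ := fun x =>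
    g (ext x) * ∑' j, p h (x (Fin.last n)) j * f (x (Fin.last n)) j with hH
  have hF1 : ∀ z, |F z| ≤ 1 := fun z => by
    rw [hF, abs_mul]
    exact mul_le_one₀ (hg _) (abs_nonneg _) (hf _ _)
  have hH1 : ∀ x, |H x| ≤ 1 := fun x => by
    rw [hH, abs_mul]
    exact mul_le_one₀ (hg _) (abs_nonneg _) (hp.abs_tsum_mul_le hh0 _ (hf _))
  have hL : ∫ ω, g (fun k => X (τ k) ω) * f (X (τ n) ω) (X (τ (n + 1)) ω) ∂μ
      = ∫ z, F z ∂(μ.map fun ω => (π ω, X (τ (n + 1)) ω)) := by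
    rw [integral_map hψm.aemeasurable Measurable.of_discrete.aestronglyMeasurable]
    exact integral_congr_ae (Eventually.of_forall fun ω => by simp only [hF, hgπ]; rfl)
  have hR : ∫ ω, g (fun k => X (τ k) ω) *
        ∑' j, p h (X (τ n) ω) j * f (X (τ n) ω) j ∂μ = ∫ x, H x ∂(μ.map π) := by
    rw [integral_map hπm.aemeasurable Measurable.of_discrete.aestronglyMeasurable]
    exact integral_congr_ae (Eventually.of_forall fun ω => by simp only [hH, hgπ]; rfl)
  rw [hL, hR]
  have : IsProbabilityMeasure (μ.map fun ω => (π ω, X (τ (n + 1)) ω)) :=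
    Measure.isProbabilityMeasure_map hψm.aemeasurable
  have : IsProbabilityMeasure (μ.map π) := Measure.isProbabilityMeasure_map hπm.aemeasurable
  -- The Markov property as an identity between atoms; what remains is summation over a countable
  -- space.
  have hsingle : ∀ x j, (μ.map fun ω => (π ω, X (τ (n + 1)) ω)).real {(x, j)}
      = (μ.map π).real {x} * p h (x (Fin.last n)) j := by
    intro x j
    have hm := hX.markov n τ (fun k => if k ≤ n then ext x k else j) hτ
    rw [map_measureReal_apply hψm (measurableSet_singleton _),
      map_measureReal_apply hπm (measurableSet_singleton _)]
    have hπx : ∀ ω, π ω = x ↔ ∀ k ≤ n, X (τ k) ω = ext x k := fun ω => by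
      rw [funext_iff]
      constructor
      · intro hx k hk
        simpa [hext, min_eq_left hk] using hx ⟨k, by omega⟩
      · rintro hx ⟨k, hk⟩
        have hk' : k ≤ n := by omega
        simpa [hext, min_eq_left hk'] using hx k hk'
    have h₁ : (fun ω => (π ω, X (τ (n + 1)) ω)) ⁻¹' {(x, j)} =
        {ω | ∀ k ≤ n + 1, X (τ k) ω = if k ≤ n then ext x k else j} := by
      ext ω
      simp only [mem_preimage, mem_singleton_iff, Prod.mk.injEq, hπx, mem_ofPred_eq]
      constructor
      · rintro ⟨h₁, h₂⟩ k hk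
        split_ifs with hkn
        · exact h₁ k hkn
        · rwa [show k = n + 1 by omega]
      · intro hx
        exact ⟨fun k hk => by simpa [hk] using hx k (by omega), by simpa using hx (n + 1) le_rfl⟩
    have h₂ : π ⁻¹' {x} = {ω | ∀ k ≤ n, X (τ k) ω = if k ≤ n then ext x k else j} := by
      ext ω
      simp only [mem_preimage, mem_singleton_iff, hπx, mem_ofPred_eq]
      exact forall₂_congr fun k hk => by rw [if_pos hk]
    rw [h₁, h₂, hm, if_pos le_rfl, if_neg (by omega)]
    simp only [hext, min_self]
    rfl
  have hsum := hasSum_measureReal_singleton_mul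
    (μ.map fun ω => (π ω, X (τ (n + 1)) ω)) hF1
  have hfib := hsum.prod_fiberwise (g := fun x => (μ.map π).real {x} * H x) fun x => by
    have h₁ := ((hp.summable_mul_of_le hh0 (x (Fin.last n)) (hf (x (Fin.last n)))).hasSum.mul_left
      (g (ext x))).mul_left ((μ.map π).real {x})
    refine h₁.congr_fun fun j => ?_
    rw [hsingle]
    ring
  exact hfib.unique (hasSum_measureReal_singleton_mul _ hH1)

theorem decrements_succ (i : ℕ → ℕ) (n : ℕ) (v : ℝ) :
    v ^ decrements i (n + 1) = v ^ decrements i n * deathWeight v (i n) (i (n + 1)) := by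
  rw [decrements, Finset.sum_range_succ, pow_add, ← decrements, deathWeight]
  split_ifs <;> simp

theorem decrements_congr {i i' : ℕ → ℕ} {n : ℕ} (h : ∀ k ≤ n, i k = i' k) :
    decrements i n = decrements i' n :=
  Finset.sum_congr rfl fun k hk => by
    rw [Finset.mem_range] at hk
    rw [h k hk.le, h (k + 1) hk]

theorem measurable_decrements (hX : ∀ t, Measurable (X t)) (τ : ℕ → ℝ≥0) (n : ℕ) :
    Measurable fun ω => decrements (fun k => X (τ k) ω) n :=
  Finset.measurable_sum _ fun k _ =>
    (Measurable.of_discrete (f := fun q : ℕ × ℕ => if q.1 + 1 = q.2 then 1 else 0)).comp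
      ((hX (τ (k + 1))).prodMk (hX (τ k)))

theorem abs_pow_le_one {x : ℝ} (hx : x ∈ Icc (0 : ℝ) 1) (n : ℕ) : |x ^ n| ≤ 1 := by
  rw [abs_of_nonneg (pow_nonneg hx.1 n)]
  exact pow_le_one₀ hx.1 hx.2

theorem integrable_pow_decrements_mul [IsProbabilityMeasure μ] (hX : ∀ t, Measurable (X t))
    (τ : ℕ → ℝ≥0) (n : ℕ) {v : ℝ} (hv : v ∈ Icc (0 : ℝ) 1) {f : ℕ → ℝ} {C : ℝ}
    (hf : ∀ i, |f i| ≤ C) (t : ℝ≥0) :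
    Integrable (fun ω => v ^ decrements (fun k => X (τ k) ω) n * f (X t ω)) μ := by
  refine Integrable.of_bound (C := 1 * C) ?_ (Eventually.of_forall fun ω => ?_)
  · exact (((Measurable.of_discrete (f := fun k : ℕ => v ^ k)).comp
      (measurable_decrements hX τ n)).mul
      ((Measurable.of_discrete (f := f)).comp (hX t))).aestronglyMeasurable
  · rw [Real.norm_eq_abs, abs_mul]
    exact mul_le_mul (abs_pow_le_one hv _) (hf _) (abs_nonneg _) zero_le_one

/-- The quantity `a k`, the expectation of `v ^ decrements` up to step `k` times `z (t - τ k) ^ X (τ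
k)`, runs from `z t` (as `X 0 = 1`) to the integral in question. Each of the `n + 1` steps of length
`h = t / (n + 1)` costs at most `C * h * h`. -/
theorem exists_grid_bound [IsProbabilityMeasure μ] (hb : IsBranchingRate b)
    (hp : IsBranchingTransition b p) (hX : IsMarkovChain p X μ) (hX0 : ∀ᵐ ω ∂μ, X 0 ω = 1)
    {u v : ℝ} (hu : u ∈ Ico (0 : ℝ) 1) (hv : v ∈ Icc (0 : ℝ) 1) {z : ℝ → ℝ}
    (hz : IsSolution b u v z) (t : ℝ≥0) :
    ∃ C, ∀ n : ℕ, |∫ ω, v ^ decrements (fun k => X (grid t n k) ω) (n + 1) * u ^ X t ω ∂μ - z t|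
      ≤ C / (n + 1) := by
  have hb0 := hb.nonneg 0 (by norm_num)
  have hv1 : (1 : ℝ) ∈ Icc (0 : ℝ) 1 := ⟨zero_le_one, le_rfl⟩
  set r₁ := barrier (b 0) u t with hr₁
  have hr₁0 : 0 ≤ r₁ := hu.1.trans (MBP.le_barrier hb0 hu.2 t t.2)
  have hr₁1 : r₁ < 1 := barrier_lt_one hu.2 _ _
  -- A second barrier is needed: the auxiliary solutions `y` start at values of `z`, which may be as
  -- large as `r₁`, and then run on.
  set r := barrier (b 0) r₁ t with hr
  have hr₁r : r₁ ≤ r := MBP.le_barrier hb0 hr₁1 t t.2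
  have hr1 : r < 1 := barrier_lt_one hr₁1 _ _
  obtain ⟨C, hC, hstep⟩ := hp.exists_step_bound hb hv (hr₁0.trans hr₁r) hr1
  refine ⟨C * t * t, fun n => ?_⟩
  set h : ℝ := t / (n + 1) with hh
  have hh0 : 0 ≤ h := by positivity
  set τ := grid t n with hτ
  have hτm : Monotone τ := grid_monotone t n
  have hτt : ∀ k ≤ n + 1, τ k ≤ t := fun k hk => (hτm hk).trans_eq (grid_last t n)
  have hzr : ∀ s : ℝ, 0 ≤ s → s ≤ t → z s ≤ r₁ := fun s hs hst =>
    (hz.le_barrier hb hv hu.2 le_rfl hs).trans (barrier_mono hb0 hu.2.le hst)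
  set a : ℕ → ℝ := fun k =>
    ∫ ω, v ^ decrements (fun k => X (τ k) ω) k * z (t - τ k) ^ X (τ k) ω ∂μ with ha
  have hinc : ∀ k < n + 1, |a (k + 1) - a k| ≤ C * h * h := by
    intro k hk
    have hσ0 : (0 : ℝ) ≤ t - τ (k + 1) := sub_nonneg.2 (by exact_mod_cast hτt (k + 1) hk)
    have hσh : (t : ℝ) - τ (k + 1) + h = t - τ k := by
      rw [hh, ← grid_succ_sub t n k]
      ring
    have hσt : (t : ℝ) - τ k ≤ t := sub_le_self _ (τ k).2
    have hτh : (τ (k + 1) : ℝ) - τ k = h := grid_succ_sub t n k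
    set q := z (t - τ (k + 1)) with hq
    have hqmem : q ∈ Icc (0 : ℝ) 1 := hz.mem _ hσ0
    have hqr : q ≤ r₁ := hzr _ hσ0 (by linarith)
    obtain ⟨y, hy⟩ := exists_solution hb hv1 ⟨hqmem.1, hqr.trans_lt hr₁1⟩
    -- The solution restarted from `q` reaches `z (t - τ k)` after time `h`.
    have hbd := hstep q y _ hy (hz.shift hσ0) h hh0 fun s hs => by
      have hst : s ≤ t := hs.2.trans (by linarith)
      exact ⟨(hy.le_barrier hb hv1 hr₁1 hqr hs.1).trans (barrier_mono hb0 hr₁1.le hst),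
        (hzr _ (add_nonneg hσ0 hs.1) (by linarith [hs.2])).trans hr₁r⟩
    rw [hσh] at hbd
    have hw : ∀ i j, |deathWeight v i j * q ^ j| ≤ 1 := fun i j => by
      rw [abs_mul]
      exact mul_le_one₀ (abs_deathWeight_le hv i j) (abs_nonneg _) (abs_pow_le_one hqmem j)
    have hsucc : a (k + 1) = ∫ ω, v ^ decrements (fun k => X (τ k) ω) k *
        ∑' j, p h (X (τ k) ω) j * (deathWeight v (X (τ k) ω) j * q ^ j) ∂μ := by
      rw [← hτh, ← hX.integral_mul hp.toIsTransitionFunction hτm k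
        (g := fun i => v ^ decrements i k) (f := fun i j => deathWeight v i j * q ^ j)
        (fun i i' hi => by rw [decrements_congr hi]) (fun i => abs_pow_le_one hv _) hw]
      refine integral_congr_ae (Eventually.of_forall fun ω => ?_)
      simp only [decrements_succ]
      ring
    rw [hsucc, ha, ← integral_sub (integrable_pow_decrements_mul hX.measurable τ k hv
        (f := fun i => ∑' j, p h i j * (deathWeight v i j * q ^ j))
        (fun i => hp.abs_tsum_mul_le hh0 i (hw i)) (τ k))
      (integrable_pow_decrements_mul hX.measurable τ k hv
        (fun i => abs_pow_le_one (hz.mem _ (hσh ▸ add_nonneg hσ0 hh0)) i) (τ k))]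
    have hnorm := norm_integral_le_of_norm_le_const (μ := μ) (C := C * h * h)
      (f := fun ω => v ^ decrements (fun k => X (τ k) ω) k *
        ∑' j, p h (X (τ k) ω) j * (deathWeight v (X (τ k) ω) j * q ^ j) -
        v ^ decrements (fun k => X (τ k) ω) k * z (t - τ k) ^ X (τ k) ω)
      (Eventually.of_forall fun ω => by
        rw [← mul_sub, norm_mul, ← one_mul (C * h * h)]
        exact mul_le_mul (abs_pow_le_one hv _) (hbd _) (norm_nonneg _) zero_le_one)
    simpa using hnorm
  have htot : ∀ k ≤ n + 1, |a k - a 0| ≤ k * (C * h * h) := by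
    intro k
    induction k with
    | zero => simp
    | succ k ih =>
      intro hk
      have h₁ := abs_sub_le (a (k + 1)) (a k) (a 0)
      have h₂ := hinc k hk
      have h₃ := ih (by omega)
      push_cast
      linarith
  have ha0 : a 0 = z t := by
    have : ∀ᵐ ω ∂μ, v ^ decrements (fun k => X (τ k) ω) 0 * z (t - τ 0) ^ X (τ 0) ω = z t := by
      filter_upwards [hX0] with ω hω
      simp [hτ, grid_zero, hω, decrements]
    rw [ha]
    simp only [integral_congr_ae this, integral_const, probReal_univ, one_smul]
  have haN : a (n + 1) = ∫ ω, v ^ decrements (fun k => X (τ k) ω) (n + 1) * u ^ X t ω ∂μ := by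
    simp only [ha, hτ, grid_last, sub_self, hz.init]
  have := htot (n + 1) le_rfl
  rw [ha0, haN] at this
  refine this.trans_eq ?_
  rw [hh]
  push_cast
  field_simp

theorem IsMarkovBranchingProcess.aemeasurable_deathNumber (hX : IsMarkovBranchingProcess b X μ)
    (t : ℝ≥0) : AEMeasurable (deathNumber X t) μ := by
  obtain ⟨p, -, hc⟩ := hX.chain
  refine aemeasurable_of_tendsto_metrizable_ae atTop
    (fun n => (measurable_decrements hc.measurable (grid t n) (n + 1)).aemeasurable) ?_
  filter_upwards [hX.path] with ω hω
  exact tendsto_const_nhds.congr' ((hω.eventually_decrements_eq t).mono fun n hn => hn.symm)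

/-- The joint generating function of the death number and the population size. -/
theorem IsMarkovBranchingProcess.integral_pow_mul_pow [IsProbabilityMeasure μ]
    (hX : IsMarkovBranchingProcess b X μ)
    (hX0 : ∀ᵐ ω ∂μ, X 0 ω = 1) {u v : ℝ} (hu : u ∈ Ico (0 : ℝ) 1) (hv : v ∈ Icc (0 : ℝ) 1)
    {z : ℝ → ℝ} (hz : IsSolution b u v z) (t : ℝ≥0) :
    ∫ ω, v ^ deathNumber X t ω * u ^ X t ω ∂μ = z t := by
  obtain ⟨p, hp, hc⟩ := hX.chain
  have hu' : u ∈ Icc (0 : ℝ) 1 := ⟨hu.1, hu.2.le⟩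
  obtain ⟨C, hC⟩ := exists_grid_bound hX.rate hp hc hX0 hu hv hz t
  have h₁ : Tendsto (fun n : ℕ => ∫ ω, v ^ decrements (fun k => X (grid t n k) ω) (n + 1)
      * u ^ X t ω ∂μ) atTop (𝓝 (∫ ω, v ^ deathNumber X t ω * u ^ X t ω ∂μ)) := by
    refine tendsto_integral_of_dominated_convergence (fun _ => 1 * 1) (fun n => ?_)
      (integrable_const _) (fun n => Eventually.of_forall fun ω => ?_) ?_
    · exact (integrable_pow_decrements_mul hc.measurable (grid t n) (n + 1) hv
        (f := fun i => u ^ i) (fun i => abs_pow_le_one hu' i) t).aestronglyMeasurable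
    · rw [norm_mul]
      exact mul_le_mul (abs_pow_le_one hv _) (abs_pow_le_one hu' _) (norm_nonneg _) zero_le_one
    · filter_upwards [hX.path] with ω hω
      refine tendsto_const_nhds.congr' ((hω.eventually_decrements_eq t).mono fun n hn => ?_)
      simp only [hn]
      rfl
  have h₂ : Tendsto (fun n : ℕ => ∫ ω, v ^ decrements (fun k => X (grid t n k) ω) (n + 1)
      * u ^ X t ω ∂μ) atTop (𝓝 (z t)) := by
    rw [tendsto_iff_norm_sub_tendsto_zero]
    refine squeeze_zero (fun n => norm_nonneg _) hC ?_
    exact ((tendsto_const_div_atTop_nhds_zero_nat C).comp (tendsto_add_atTop_nat 1)).congr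
      fun n => by simp
  exact tendsto_nhds_unique h₁ h₂

end BranchingProcess

/-! ### Initial value `1`: existence and uniqueness through the process. -/

section Main

variable {Ω : Type*} [MeasurableSpace Ω] {μ : Measure Ω} {b : ℕ → ℝ} {X : ℝ≥0 → Ω → ℕ} {v : ℝ}

/-- The generating function of the death number, as a function of the time. -/
noncomputable def deathPGF (X : ℝ≥0 → Ω → ℕ) (μ : Measure Ω) (v t : ℝ) : ℝ :=
  ∫ ω, v ^ deathNumber X t.toNNReal ω ∂μ

/-- Dominated convergence removes the factor `u ^ X` from the joint formula. Since `u` and `z` are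
arbitrary, this serves both existence and uniqueness at `1`. -/
theorem IsMarkovBranchingProcess.tendsto_deathPGF [IsProbabilityMeasure μ]
    (hX : IsMarkovBranchingProcess b X μ) (hX0 : ∀ᵐ ω ∂μ, X 0 ω = 1) (hv : v ∈ Icc (0 : ℝ) 1)
    {u : ℕ → ℝ} (hu : ∀ n, u n ∈ Ico (0 : ℝ) 1) (hu1 : Tendsto u atTop (𝓝 1)) {z : ℕ → ℝ → ℝ}
    (hz : ∀ n, IsSolution b (u n) v (z n)) {t : ℝ} (ht : 0 ≤ t) :
    Tendsto (fun n => z n t) atTop (𝓝 (deathPGF X μ v t)) := by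
  obtain ⟨p, -, hc⟩ := hX.chain
  have heq : ∀ n, ∫ ω, v ^ deathNumber X t.toNNReal ω * u n ^ X t.toNNReal ω ∂μ = z n t := by
    intro n
    rw [hX.integral_pow_mul_pow hX0 (hu n) hv (hz n), Real.coe_toNNReal t ht]
  simp only [← heq]
  have hY : AEStronglyMeasurable (fun ω => v ^ deathNumber X t.toNNReal ω) μ :=
    ((Measurable.of_discrete (f := fun k : ℕ => v ^ k)).comp_aemeasurable
      (hX.aemeasurable_deathNumber t.toNNReal)).aestronglyMeasurable
  refine tendsto_integral_of_dominated_convergence (fun _ => 1 * 1)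
    (fun n => hY.mul ((Measurable.of_discrete (f := fun k : ℕ => u n ^ k)).comp
      (hc.measurable t.toNNReal)).aestronglyMeasurable)
    (integrable_const _) (fun n => Eventually.of_forall fun ω => ?_)
    (Eventually.of_forall fun ω => ?_)
  · rw [norm_mul]
    exact mul_le_mul (abs_pow_le_one hv _) (abs_pow_le_one ⟨(hu n).1, (hu n).2.le⟩ _)
      (norm_nonneg _) zero_le_one
  · simpa using (hu1.pow (X t.toNNReal ω)).const_mul (v ^ deathNumber X t.toNNReal ω)

theorem IsSolution.sub_eq_integral (hb : IsBranchingRate b) {u : ℝ} {y : ℝ → ℝ}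
    (hy : IsSolution b u v y) {t : ℝ} (ht : 0 ≤ t) :
    ∫ s in (0 : ℝ)..t, (B b (y s) - b 0 * (1 - v)) = y t - u := by
  rw [← hy.init]
  refine intervalIntegral.integral_eq_sub_of_hasDeriv_right_of_le ht
    (hy.continuousOn.mono Icc_subset_Ici_self)
    (fun s hs => (hy.deriv s hs.1.le).mono (Ioi_subset_Ici hs.1.le)) ?_
  refine ContinuousOn.intervalIntegrable ?_
  rw [uIcc_of_le ht]
  exact (hb.continuousOn_B.comp (hy.continuousOn.mono Icc_subset_Ici_self)
    fun s hs => hy.mem s hs.1).sub continuousOn_const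

/-- Approximate by solutions from `u n → 1`. Their common Lipschitz constant passes to the limit,
and so does the integral equation, as `B` is continuous up to `1`; differentiating it gives the
claim. -/
theorem IsMarkovBranchingProcess.isSolution_deathPGF [IsProbabilityMeasure μ]
    (hX : IsMarkovBranchingProcess b X μ) (hX0 : ∀ᵐ ω ∂μ, X 0 ω = 1) (hv : v ∈ Icc (0 : ℝ) 1) :
    IsSolution b 1 v (deathPGF X μ v) := by
  have hb := hX.rate
  set L := deathPGF X μ v
  obtain ⟨u, -, hu, hu1⟩ := exists_seq_strictMono_tendsto' (zero_lt_one (α := ℝ))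
  have hu01 : ∀ n, u n ∈ Ico (0 : ℝ) 1 := fun n => Ioo_subset_Ico_self (hu n)
  choose z hz using fun n => exists_solution hb hv (hu01 n)
  have hlim : ∀ t, 0 ≤ t → Tendsto (fun n => z n t) atTop (𝓝 (L t)) := fun t ht =>
    hX.tendsto_deathPGF hX0 hv hu01 hu1 hz ht
  have hmem : ∀ t, 0 ≤ t → L t ∈ Icc (0 : ℝ) 1 := fun t ht =>
    isClosed_Icc.mem_of_tendsto (hlim t ht) (Eventually.of_forall fun n => (hz n).mem t ht)
  have hinit : L 0 = 1 :=
    tendsto_nhds_unique (hlim 0 le_rfl) (by simpa only [(hz _).init] using hu1)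
  have hlip : ∀ s, 0 ≤ s → ∀ t, 0 ≤ t → |L t - L s| ≤ 3 * -b 1 * |t - s| := fun s hs t ht =>
    le_of_tendsto ((hlim t ht).sub (hlim s hs)).abs
      (Eventually.of_forall fun n => (hz n).abs_sub_le hb hv hs ht)
  -- Extending by `max s 0` makes the integrand continuous on `ℝ`, so the fundamental theorem also
  -- applies at `t = 0`.
  have hcont : Continuous fun s => L (max s 0) := by
    have hc : ContinuousOn L (Ici 0) :=
      (LipschitzOnWith.of_dist_le_mul (K := ⟨3 * -b 1, by linarith [hb.pos]⟩)
        fun t ht s hs => hlip s hs t ht).continuousOn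
    exact hc.comp_continuous (by fun_prop) fun s => le_max_right s 0
  have hgcont : Continuous fun s => B b (L (max s 0)) - b 0 * (1 - v) :=
    (hb.continuousOn_B.comp_continuous hcont fun s => hmem _ (le_max_right s 0)).sub
      continuous_const
  have hint : ∀ t, 0 ≤ t →
      1 + ∫ s in (0 : ℝ)..t, (B b (L (max s 0)) - b 0 * (1 - v)) = L t := by
    intro t ht
    have h₁ : Tendsto (fun n => ∫ s in (0 : ℝ)..t, (B b (z n s) - b 0 * (1 - v))) atTop
        (𝓝 (∫ s in (0 : ℝ)..t, (B b (L (max s 0)) - b 0 * (1 - v)))) := by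
      refine intervalIntegral.tendsto_integral_filter_of_dominated_convergence
        (fun _ => 3 * -b 1) (Eventually.of_forall fun n => ?_)
        (Eventually.of_forall fun n => Eventually.of_forall fun s hs => ?_)
        intervalIntegrable_const (Eventually.of_forall fun s hs => ?_)
      · rw [uIoc_of_le ht]
        exact ((hb.continuousOn_B.comp ((hz n).continuousOn.mono
          (Ioc_subset_Icc_self.trans Icc_subset_Ici_self)) fun s hs => (hz n).mem s hs.1.le).sub
          continuousOn_const).aestronglyMeasurable measurableSet_Ioc
      · rw [uIoc_of_le ht] at hs
        exact abs_B_sub_le hb hv ((hz n).mem s hs.1.le)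
      · rw [uIoc_of_le ht] at hs
        rw [max_eq_left hs.1.le]
        refine Tendsto.sub_const ?_ _
        exact (hb.continuousOn_B (L s) (hmem s hs.1.le)).tendsto.comp
          (tendsto_nhdsWithin_iff.2 ⟨hlim s hs.1.le,
            Eventually.of_forall fun n => (hz n).mem s hs.1.le⟩)
    simp only [(hz _).sub_eq_integral hb ht] at h₁
    rw [tendsto_nhds_unique h₁ ((hlim t ht).sub hu1)]
    ring
  refine ⟨hmem, hinit, fun t ht => ?_⟩
  have h := ((hgcont.integral_hasStrictDerivAt 0 t).hasDerivAt.const_add 1).hasDerivWithinAt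
    (s := Ici 0)
  rw [max_eq_left ht] at h
  exact h.congr (fun s hs => (hint s hs).symm) (hint t ht).symm

/-- Restarted at `s₀ + ε n`, the solution has initial values below `1` that tend to `1`, so
`tendsto_deathPGF` identifies the limit. -/
theorem IsMarkovBranchingProcess.eq_deathPGF_of_lt_one [IsProbabilityMeasure μ]
    (hX : IsMarkovBranchingProcess b X μ) (hX0 : ∀ᵐ ω ∂μ, X 0 ω = 1) (hv : v ∈ Icc (0 : ℝ) 1)
    {u : ℝ} {z : ℝ → ℝ} (hz : IsSolution b u v z) {s₀ d : ℝ} (hs₀ : 0 ≤ s₀) (hd : 0 < d)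
    (h1 : z s₀ = 1) (hlt : ∀ s ∈ Ioo s₀ (s₀ + d), z s < 1) {s : ℝ} (hs : 0 ≤ s) :
    z (s₀ + s) = deathPGF X μ v s := by
  -- With `n + 2` even the first term is strictly less than `d`.
  set ε : ℕ → ℝ := fun n => d / (n + 2) with hε
  have hε0 : ∀ n, 0 < ε n := fun n => by positivity
  have hεd : ∀ n, ε n < d := fun n => div_lt_self hd (by
    have : (0 : ℝ) ≤ n := Nat.cast_nonneg n
    linarith)
  have hεlim : Tendsto ε atTop (𝓝 0) :=
    ((tendsto_const_div_atTop_nhds_zero_nat d).comp (tendsto_add_atTop_nat 2)).congr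
      fun n => by simp [hε]
  have hlim : ∀ s, 0 ≤ s → Tendsto (fun n => z (s₀ + ε n + s)) atTop (𝓝 (z (s₀ + s))) := by
    intro s hs
    refine (hz.continuousOn (s₀ + s) (add_nonneg hs₀ hs)).tendsto.comp
      (tendsto_nhdsWithin_iff.2 ⟨?_, Eventually.of_forall fun n => ?_⟩)
    · simpa using (hεlim.const_add s₀).add_const s
    · exact add_nonneg (add_nonneg hs₀ (hε0 n).le) hs
  refine tendsto_nhds_unique (hlim s hs) (hX.tendsto_deathPGF hX0 hv (u := fun n => z (s₀ + ε n))
    (fun n => ⟨(hz.mem _ (add_nonneg hs₀ (hε0 n).le)).1, hlt _ ⟨?_, ?_⟩⟩) ?_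
    (fun n => hz.shift (add_nonneg hs₀ (hε0 n).le)) hs)
  · linarith [hε0 n]
  · linarith [hεd n]
  · simpa [h1] using hlim 0 le_rfl

/-- The equation is then the one for `v = 1`, so the same approximating solutions converge to both
generating functions, and the one for `v = 1` is trivially `1`. -/
theorem IsMarkovBranchingProcess.deathPGF_eq_one [IsProbabilityMeasure μ]
    (hX : IsMarkovBranchingProcess b X μ) (hX0 : ∀ᵐ ω ∂μ, X 0 ω = 1) (hv : v ∈ Icc (0 : ℝ) 1)
    (h : b 0 * (1 - v) = 0) {t : ℝ} (ht : 0 ≤ t) : deathPGF X μ v t = 1 := by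
  have hv1 : (1 : ℝ) ∈ Icc (0 : ℝ) 1 := ⟨zero_le_one, le_rfl⟩
  obtain ⟨u, -, hu, hu1⟩ := exists_seq_strictMono_tendsto' (zero_lt_one (α := ℝ))
  have hu01 : ∀ n, u n ∈ Ico (0 : ℝ) 1 := fun n => Ioo_subset_Ico_self (hu n)
  choose z hz using fun n => exists_solution hX.rate hv (hu01 n)
  have hz' : ∀ n, IsSolution b (u n) 1 (z n) := fun n =>
    ⟨(hz n).mem, (hz n).init, fun s hs => by simpa [h] using (hz n).deriv s hs⟩
  rw [tendsto_nhds_unique (hX.tendsto_deathPGF hX0 hv hu01 hu1 hz ht)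
    (hX.tendsto_deathPGF hX0 hv1 hu01 hu1 hz' ht)]
  simp [deathPGF]

/-- Uniqueness for the initial value `1`, where the equation need not be Lipschitz. -/
theorem IsMarkovBranchingProcess.eq_deathPGF [IsProbabilityMeasure μ]
    (hX : IsMarkovBranchingProcess b X μ) (hX0 : ∀ᵐ ω ∂μ, X 0 ω = 1) (hv : v ∈ Icc (0 : ℝ) 1)
    {z : ℝ → ℝ} (hz : IsSolution b 1 v z) {t : ℝ} (ht : 0 ≤ t) : z t = deathPGF X μ v t := by
  by_cases h : b 0 * (1 - v) = 0
  · rw [hX.deathPGF_eq_one hX0 hv h ht]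
    by_contra hne
    have hclosed : IsClosed (Icc 0 t ∩ z ⁻¹' {1}) :=
      (hz.continuousOn.mono Icc_subset_Ici_self).preimage_isClosed_of_isClosed isClosed_Icc
        isClosed_singleton
    have hcompact : IsCompact (Icc 0 t ∩ z ⁻¹' {1}) :=
      isCompact_Icc.of_isClosed_subset hclosed inter_subset_left
    -- Take the last time up to `t` at which the solution equals `1`; after it the solution would
    -- coincide with the constant `1`.
    obtain ⟨s₀, ⟨hs₀t, hs₀1⟩, hmax⟩ := hcompact.exists_isGreatest ⟨0, ⟨le_rfl, ht⟩, hz.init⟩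
    have hlt : s₀ < t := hs₀t.2.lt_of_ne fun heq => hne (heq ▸ hs₀1)
    have := hX.eq_deathPGF_of_lt_one hX0 hv hz hs₀t.1 (sub_pos.2 hlt) hs₀1 (fun s hs => by
      have hs0 : 0 ≤ s := hs₀t.1.trans hs.1.le
      refine (hz.mem s hs0).2.lt_of_ne fun heq => ?_
      exact (hmax ⟨⟨hs0, by linarith [hs.2]⟩, heq⟩).not_gt hs.1) (sub_nonneg.2 hlt.le)
    rw [hX.deathPGF_eq_one hX0 hv h (sub_nonneg.2 hlt.le), add_sub_cancel] at this
    exact hne this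
  -- The value `1` at a positive time is an interior maximum, with zero derivative, while the field
  -- there is `-b 0 * (1 - v) ≠ 0`.
  · have hlt : ∀ s, 0 < s → z s < 1 := fun s hs => by
      refine (hz.mem s hs.le).2.lt_of_ne fun heq => h ?_
      have hmax : IsLocalMax z s := by
        filter_upwards [Ici_mem_nhds hs] with r hr
        rw [heq]
        exact (hz.mem r hr).2
      have := hmax.hasDerivAt_eq_zero ((hz.deriv s hs.le).hasDerivAt (Ici_mem_nhds hs))
      rw [heq, hX.rate.B_at_one] at this
      linarith
    simpa using hX.eq_deathPGF_of_lt_one hX0 hv hz le_rfl one_pos hz.init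
      (fun s hs => hlt s hs.1) ht

end Main

end MBP

theorem corollary3p1 {Ω : Type*} [MeasurableSpace Ω] (μ : Measure Ω) [IsProbabilityMeasure μ]
    (b : ℕ → ℝ) (X : ℝ≥0 → Ω → ℕ) (hX : MBP.IsMarkovBranchingProcess b X μ)
    (hX0 : ∀ᵐ ω ∂μ, X 0 ω = 1) :
    ∃ G : ℝ → ℝ → ℝ → ℝ,
      (∀ u ∈ Icc (0 : ℝ) 1, ∀ v ∈ Icc (0 : ℝ) 1,
        MBP.IsSolution b u v (fun t => G t u v) ∧
        ∀ y : ℝ → ℝ, MBP.IsSolution b u v y → ∀ t, 0 ≤ t → y t = G t u v) ∧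
      ∀ t : ℝ≥0, AEMeasurable (MBP.deathNumber X t) μ ∧
        ∀ v ∈ Icc (0 : ℝ) 1, ∫ ω, v ^ MBP.deathNumber X t ω ∂μ = G t 1 v := by
  have key : ∀ u v : ℝ, ∃ g : ℝ → ℝ, (u = 1 → g = MBP.deathPGF X μ v) ∧
      (u ∈ Icc (0 : ℝ) 1 → v ∈ Icc (0 : ℝ) 1 → MBP.IsSolution b u v g ∧
        ∀ y : ℝ → ℝ, MBP.IsSolution b u v y → ∀ t, 0 ≤ t → y t = g t) := by
    intro u v
    by_cases hu1 : u = 1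
    · subst hu1
      exact ⟨_, fun _ => rfl, fun _ hv => ⟨hX.isSolution_deathPGF hX0 hv,
        fun y hy t ht => hX.eq_deathPGF hX0 hv hy ht⟩⟩
    · by_cases huv : u ∈ Icc (0 : ℝ) 1 ∧ v ∈ Icc (0 : ℝ) 1
      · have hu : u ∈ Ico (0 : ℝ) 1 := ⟨huv.1.1, huv.1.2.lt_of_ne hu1⟩
        obtain ⟨g, hg⟩ := MBP.exists_solution hX.rate huv.2 hu
        exact ⟨g, fun h => absurd h hu1, fun _ hv =>
          ⟨hg, fun y hy t ht => hy.unique hX.rate hv hu hg ht⟩⟩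
      · exact ⟨0, fun h => absurd h hu1, fun hu hv => absurd ⟨hu, hv⟩ huv⟩
  choose g hg₁ hg using key
  refine ⟨fun t u v => g u v t, fun u hu v hv => hg u v hu hv, fun t =>
    ⟨hX.aemeasurable_deathNumber t, fun v _ => ?_⟩⟩
  simp only [hg₁ 1 v rfl, MBP.deathPGF, Real.toNNReal_coe]
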